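/- Let $G$ be a Lie group and $\pi\colon P\to B$ a smooth principal $G$-bundle (with $G$ acting on $P$ on the left), so that $B=P/G$. Let $\pmb X=(X_1,\dots,X_k)$ be a smooth $G$-invariant $k$-vector field on $P$, i.e. a $k$-tuple of $G$-invariant vector fields on $P$, and let $\overline{\pmb X}=(\overline X_1,\dots,\overline X_k)$ be the reduced $k$-vector field on $P/G$, determined by $T\pi\circ X_a=\overline X_a\circ\pi$. An integral section of a $k$-vector field $\pmb Y$ on a manifold $M$ through $p\in M$ is a smooth map $\varphi\colon U\to M$, defined on some open neighbourhood $U$ of $0$ in $\mathbb R^k$, with $\varphi(0)=p$ and $T_t\varphi(\partial/\partial t^a|_t)=Y_a(\varphi(t))$ for all $t\in U$ and $a=1,\dots,k$; $\pmb Y$ is integrable if there is an integral section of $\pmb Y$ through every point of $M$. For an integral section $\overline\phi\colon U\to P/G$ of $\overline{\pmb X}$, let $\overline\phi^*P=\{(t,p)\in U\times P \mid \overline\phi(t)=\pi(p)\}\to U$ be the pullback principal $G$-bundle, and let $\mathcal H(\pmb X,\overline\phi)$ be the principal connection on it whose horizontal distribution is spanned by the (restrictions to $\overline\phi^*P$ of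 the) vector fields $Z_a=\partial/\partial t^a+X_a$, $a=1,\dots,k$. It is called flat if its curvature $K(Y,Z)=-\mathrm{Ver}([\mathrm{Hor}\,Y,\mathrm{Hor}\,Z])$ vanishes for all smooth vector fields $Y,Z$ on $\overline\phi^*P$. Then $\pmb X$ is integrable if and only if the following two conditions hold: (i) the reduced $k$-vector field $\overline{\pmb X}$ is integrable; (ii) for every open neighbourhood $U$ of $0$ in $\mathbb R^k$ and every integral section $\overline\phi\colon U\to P/G$ of $\overline{\pmb X}$, the connection $\mathcal H(\pmb X,\overline\phi)$ is flat. -/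

import Mathlib

open Set
open scoped Manifold ContDiff Topology

set_option linter.unusedSectionVars false

noncomputable section

/-! ### Constant vector fields on open subsets of a vector space -/

open TopologicalSpace in
lemma mfderiv_opens_val {E : Type*} [NormedAddCommGroup E] [NormedSpace ℝ E] {U : Opens E}
    (t : U) : HasMFDerivAt 𝓘(ℝ, E) 𝓘(ℝ, E) (Subtype.val : U → E) t
      (ContinuousLinearMap.id ℝ E) := by
  refine ⟨continuous_subtype_val.continuousAt, ?_⟩
  have h : ∀ᶠ y in 𝓝 (t : E), writtenInExtChartAt 𝓘(ℝ, E) 𝓘(ℝ, E) t (Subtype.val : U → E) y = y := by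
    filter_upwards [U.2.mem_nhds t.2] with y hy
    let e := (OpenPartialHomeomorph.refl E).subtypeRestr (s := U) ⟨t⟩
    have hy' : y ∈ e.target := by
      simpa [e, OpenPartialHomeomorph.subtypeRestr] using hy
    exact e.right_inv hy'
  have h' := (hasFDerivAt_id (𝕜 := ℝ) (t : E)).congr_of_eventuallyEq h
  exact h'.hasFDerivWithinAt

open TopologicalSpace in
lemma contMDiff_opens_const {E : Type*} [NormedAddCommGroup E] [NormedSpace ℝ E] [CompleteSpace E]
    {U : Opens E}
    (v : E) : ContMDiff 𝓘(ℝ, E) 𝓘(ℝ, E).tangent ∞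
      (fun t : U => (⟨t, v⟩ : TangentBundle 𝓘(ℝ, E) U)) := by
  have h : ContMDiff 𝓘(ℝ, E) 𝓘(ℝ, E).tangent ∞
      (fun t : E => (⟨t, v⟩ : TangentBundle 𝓘(ℝ, E) E)) :=
    contMDiff_vectorSpace_iff_contDiff.2 contDiff_const
  have h2 := h.mpullback_vectorField (n := ∞) (f := (Subtype.val : U → E)) contMDiff_subtype_val
    (fun t => by rw [(mfderiv_opens_val t).mfderiv]; exact ⟨ContinuousLinearEquiv.refl ℝ E, rfl⟩) (by simp)
  have key (t : U) : VectorField.mpullback 𝓘(ℝ, E) 𝓘(ℝ, E) (Subtype.val : U → E)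
      (fun _ => v) t = v := by
    change (mfderiv 𝓘(ℝ, E) 𝓘(ℝ, E) (Subtype.val : U → E) t).inverse v = v
    rw [(mfderiv_opens_val t).mfderiv]
    exact congrArg (fun L : E →L[ℝ] E => L v) ContinuousLinearMap.inverse_id
  exact h2.congr fun t => congrArg (Bundle.TotalSpace.mk t) (key t).symm

/-! ### `k`-vector fields and integral sections -/

section KVectorField

variable {k : ℕ}
  {E : Type*} [NormedAddCommGroup E] [NormedSpace ℝ E]
  {M : Type*} [TopologicalSpace M] [ChartedSpace E M] [IsManifold 𝓘(ℝ, E) ∞ M]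

/-- A smooth `k`-vector field `X = (X₁, …, X_k)` on a manifold `M` modelled on `E`. -/
structure KVectorField (k : ℕ) (E : Type*) [NormedAddCommGroup E] [NormedSpace ℝ E]
    (M : Type*) [TopologicalSpace M] [ChartedSpace E M] [IsManifold 𝓘(ℝ, E) ∞ M] where
  /-- the components of the `k`-vector field -/
  comp : Fin k → (x : M) → TangentSpace 𝓘(ℝ, E) x
  smooth : ∀ a, ContMDiff 𝓘(ℝ, E) 𝓘(ℝ, E).tangent ∞
    (fun x => (⟨x, comp a x⟩ : TangentBundle 𝓘(ℝ, E) M))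

/-- The standard basis vector `∂/∂tᵃ` of `ℝᵏ`. -/
abbrev dt (a : Fin k) : EuclideanSpace ℝ (Fin k) := EuclideanSpace.single a 1

/-- A smooth map `φ : U → M` on an open neighbourhood `U` of `0` in `ℝᵏ` is an integral section
of `X` if `T_t φ (∂/∂tᵃ) = X_a (φ t)` for all `t ∈ U` and all `a`. -/
def KVectorField.IsIntegralSection (X : KVectorField k E M)
    {U : TopologicalSpace.Opens (EuclideanSpace ℝ (Fin k))}
    (φ : C^∞⟮𝓘(ℝ, EuclideanSpace ℝ (Fin k)), U; 𝓘(ℝ, E), M⟯) : Prop :=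
  (0 : EuclideanSpace ℝ (Fin k)) ∈ U ∧
    ∀ (t : U) (a : Fin k),
      mfderiv 𝓘(ℝ, EuclideanSpace ℝ (Fin k)) 𝓘(ℝ, E) φ t (dt a) = X.comp a (φ t)

/-- `X` is integrable if there is an integral section of `X` through every point. -/
def KVectorField.IsIntegrable (X : KVectorField k E M) : Prop :=
  ∀ p : M, ∃ (U : TopologicalSpace.Opens (EuclideanSpace ℝ (Fin k)))
    (φ : C^∞⟮𝓘(ℝ, EuclideanSpace ℝ (Fin k)), U; 𝓘(ℝ, E), M⟯),
    X.IsIntegralSection φ ∧ ∀ t : U, (t : EuclideanSpace ℝ (Fin k)) = 0 → φ t = p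

end KVectorField

/-! ### Principal bundles -/

section PrincipalBundle

variable
  {EG : Type*} [NormedAddCommGroup EG] [NormedSpace ℝ EG]
  {EP : Type*} [NormedAddCommGroup EP] [NormedSpace ℝ EP]
  {EB : Type*} [NormedAddCommGroup EB] [NormedSpace ℝ EB]
  {G : Type*} [TopologicalSpace G] [ChartedSpace EG G] [Group G] [LieGroup 𝓘(ℝ, EG) ∞ G]
  {P : Type*} [TopologicalSpace P] [ChartedSpace EP P] [IsManifold 𝓘(ℝ, EP) ∞ P]
  [MulAction G P] [ContMDiffSMul 𝓘(ℝ, EG) 𝓘(ℝ, EP) ∞ G P]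
  {B : Type*} [TopologicalSpace B] [ChartedSpace EB B] [IsManifold 𝓘(ℝ, EB) ∞ B]

/-- A (smooth) principal `G`-bundle with total space `P` and base `B`, for a smooth left action of
the Lie group `G` on `P`: a `G`-invariant map `proj : P → B` which near every point of `B` admits
a smooth `G`-equivariant local trivialization. In particular `proj` is a surjective submersion,
the action is free and the fibres of `proj` are the orbits, so that `B = P / G`. -/
structure PrincipalBundle
    (EG : Type*) [NormedAddCommGroup EG] [NormedSpace ℝ EG]
    (EP : Type*) [NormedAddCommGroup EP] [NormedSpace ℝ EP]
    (EB : Type*) [NormedAddCommGroup EB] [NormedSpace ℝ EB]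
    (G : Type*) [TopologicalSpace G] [ChartedSpace EG G] [Group G] [LieGroup 𝓘(ℝ, EG) ∞ G]
    (P : Type*) [TopologicalSpace P] [ChartedSpace EP P] [IsManifold 𝓘(ℝ, EP) ∞ P]
    [MulAction G P] [ContMDiffSMul 𝓘(ℝ, EG) 𝓘(ℝ, EP) ∞ G P]
    (B : Type*) [TopologicalSpace B] [ChartedSpace EB B] [IsManifold 𝓘(ℝ, EB) ∞ B] where
  /-- the bundle projection -/
  proj : P → B
  proj_smul : ∀ (g : G) (p : P), proj (g • p) = proj p
  exists_trivialization : ∀ b : B, ∃ e : Bundle.Trivialization G proj, b ∈ e.baseSet ∧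
    ContMDiffOn 𝓘(ℝ, EP) (𝓘(ℝ, EB).prod 𝓘(ℝ, EG)) ∞ e e.source ∧
    ContMDiffOn (𝓘(ℝ, EB).prod 𝓘(ℝ, EG)) 𝓘(ℝ, EP) ∞ e.toOpenPartialHomeomorph.symm e.target ∧
    ∀ (g : G), ∀ p ∈ e.source, e (g • p) = (proj p, g * (e p).2)

namespace PrincipalBundle

variable (ξ : PrincipalBundle EG EP EB G P B)

/-- A chosen smooth equivariant local trivialization around `b`. -/
def triv (b : B) : Bundle.Trivialization G ξ.proj := (ξ.exists_trivialization b).choose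

lemma mem_triv (b : B) : b ∈ (ξ.triv b).baseSet :=
  (ξ.exists_trivialization b).choose_spec.1

lemma contMDiffOn_triv (b : B) :
    ContMDiffOn 𝓘(ℝ, EP) (𝓘(ℝ, EB).prod 𝓘(ℝ, EG)) ∞ (ξ.triv b) (ξ.triv b).source :=
  (ξ.exists_trivialization b).choose_spec.2.1

lemma contMDiffOn_triv_symm (b : B) :
    ContMDiffOn (𝓘(ℝ, EB).prod 𝓘(ℝ, EG)) 𝓘(ℝ, EP) ∞
      (ξ.triv b).toOpenPartialHomeomorph.symm (ξ.triv b).target :=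
  (ξ.exists_trivialization b).choose_spec.2.2.1

lemma triv_smul (b : B) (g : G) {p : P} (hp : ξ.proj p ∈ (ξ.triv b).baseSet) :
    ξ.triv b (g • p) = (ξ.proj p, g * (ξ.triv b p).2) :=
  (ξ.exists_trivialization b).choose_spec.2.2.2 g p ((ξ.triv b).mem_source.2 hp)

lemma contMDiff_proj : ContMDiff 𝓘(ℝ, EP) 𝓘(ℝ, EB) ∞ ξ.proj := by
  intro p
  have hs : p ∈ (ξ.triv (ξ.proj p)).source := (ξ.triv _).mem_source.2 (ξ.mem_triv _)
  have h := (ξ.contMDiffOn_triv (ξ.proj p)).contMDiffAt ((ξ.triv _).open_source.mem_nhds hs)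
  exact (contMDiffAt_fst.comp p h).congr_of_eventuallyEq
    ((ξ.triv _).coe_fst_eventuallyEq_proj hs).symm

lemma surjective_proj : Function.Surjective ξ.proj := fun b =>
  ⟨(ξ.triv b).toOpenPartialHomeomorph.symm (b, 1), (ξ.triv b).proj_symm_apply' (ξ.mem_triv b)⟩

/-- Points in the same fibre are in the same orbit. -/
lemma exists_smul_eq {p q : P} (h : ξ.proj p = ξ.proj q) : ∃ g : G, g • p = q := by
  set e := ξ.triv (ξ.proj p) with he
  have hp : ξ.proj p ∈ e.baseSet := ξ.mem_triv _
  have hq : ξ.proj q ∈ e.baseSet := h ▸ hp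
  refine ⟨(e q).2 * (e p).2⁻¹, ?_⟩
  apply e.injOn (e.mem_source.2 (by rwa [ξ.proj_smul])) (e.mem_source.2 hq)
  change e _ = e q
  rw [he, ξ.triv_smul _ _ hp, ← he, inv_mul_cancel_right, h, e.mk_proj_snd' hq]

/-! #### Invariant `k`-vector fields and their reduction -/

variable {k : ℕ}

variable (G) in
/-- `G`-invariance of a `k`-vector field: `T Φ_g ∘ X_a = X_a ∘ Φ_g`. -/
def _root_.KVectorField.IsInvariant (X : KVectorField k EP P) : Prop :=
  ∀ (g : G) (a : Fin k) (p : P),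
    mfderiv 𝓘(ℝ, EP) 𝓘(ℝ, EP) (fun q : P => g • q) p (X.comp a p) = X.comp a (g • p)

lemma contMDiff_smul_left (EG : Type*) [NormedAddCommGroup EG] [NormedSpace ℝ EG]
    {EP : Type*} [NormedAddCommGroup EP] [NormedSpace ℝ EP]
    {G : Type*} [TopologicalSpace G] [ChartedSpace EG G] [Group G]
    {P : Type*} [TopologicalSpace P] [ChartedSpace EP P]
    [MulAction G P] [ContMDiffSMul 𝓘(ℝ, EG) 𝓘(ℝ, EP) ∞ G P] (g : G) :
    ContMDiff 𝓘(ℝ, EP) 𝓘(ℝ, EP) ∞ (fun p : P => g • p) :=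
  (contMDiff_smul (I := 𝓘(ℝ, EG)) (G := G)).comp (contMDiff_const.prodMk contMDiff_id)

/-- The value at `b` of the projection of the vector field `X_a`: the image under `T proj` of
`X_a p`, where `p` is a chosen point over `b`. For invariant `X` this is independent of the
choice, see `reducedComp_proj`. -/
def reducedComp (X : KVectorField k EP P) (a : Fin k) (b : B) : TangentSpace 𝓘(ℝ, EB) b :=
  mfderiv 𝓘(ℝ, EP) 𝓘(ℝ, EB) ξ.proj (Function.surjInv ξ.surjective_proj b)
    (X.comp a (Function.surjInv ξ.surjective_proj b))

lemma mfderiv_proj_smul {X : KVectorField k EP P} (hX : X.IsInvariant G) (a : Fin k)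
    (g : G) (p : P) :
    (mfderiv 𝓘(ℝ, EP) 𝓘(ℝ, EB) ξ.proj (g • p) (X.comp a (g • p)) : EB) =
      mfderiv 𝓘(ℝ, EP) 𝓘(ℝ, EB) ξ.proj p (X.comp a p) := by
  rw [← hX g a p]
  have h1 : MDifferentiableAt 𝓘(ℝ, EP) 𝓘(ℝ, EB) ξ.proj (g • p) :=
    ξ.contMDiff_proj.mdifferentiable (by simp) _
  have h2 : MDifferentiableAt 𝓘(ℝ, EP) 𝓘(ℝ, EP) (fun q : P => g • q) p :=
    (contMDiff_smul_left EG g).mdifferentiable (by simp) _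
  have h3 : ξ.proj ∘ (fun q : P => g • q) = ξ.proj := funext fun q => ξ.proj_smul g q
  have h4 := mfderiv_comp p h1 h2
  rw [h3] at h4
  rw [h4]
  rfl

/-- The defining relation `T proj ∘ X_a = X̄_a ∘ proj` of the reduced `k`-vector field. -/
lemma reducedComp_proj {X : KVectorField k EP P} (hX : X.IsInvariant G) (a : Fin k) (p : P) :
    mfderiv 𝓘(ℝ, EP) 𝓘(ℝ, EB) ξ.proj p (X.comp a p) = ξ.reducedComp X a (ξ.proj p) := by
  obtain ⟨g, hg⟩ := ξ.exists_smul_eq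
    (p := p) (q := Function.surjInv ξ.surjective_proj (ξ.proj p))
    (Function.surjInv_eq ξ.surjective_proj _).symm
  have h := ξ.mfderiv_proj_smul hX a g p
  rw [hg] at h
  exact h.symm

lemma contMDiff_reducedComp {X : KVectorField k EP P} (hX : X.IsInvariant G) (a : Fin k) :
    ContMDiff 𝓘(ℝ, EB) 𝓘(ℝ, EB).tangent ∞
      (fun b => (⟨b, ξ.reducedComp X a b⟩ : TangentBundle 𝓘(ℝ, EB) B)) := by
  intro b
  set e := ξ.triv b with he
  have hb : b ∈ e.baseSet := ξ.mem_triv b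
  have hσ : ContMDiffAt 𝓘(ℝ, EB) 𝓘(ℝ, EP) ∞
      (fun c => e.toOpenPartialHomeomorph.symm (c, (1 : G))) b := by
    have h := (ξ.contMDiffOn_triv_symm b).contMDiffAt
      (x := (b, (1 : G))) (e.open_target.mem_nhds (e.mem_target.2 hb))
    exact h.comp b (contMDiffAt_id.prodMk contMDiffAt_const)
  have hT : ContMDiff 𝓘(ℝ, EP).tangent 𝓘(ℝ, EB).tangent ∞
      (tangentMap 𝓘(ℝ, EP) 𝓘(ℝ, EB) ξ.proj) :=
    ξ.contMDiff_proj.contMDiff_tangentMap (by simp)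
  have h := (hT.comp (X.smooth a)).contMDiffAt.comp b hσ
  refine h.congr_of_eventuallyEq ?_
  filter_upwards [e.open_baseSet.mem_nhds hb] with c hc
  have hc' : ξ.proj (e.toOpenPartialHomeomorph.symm (c, (1 : G))) = c := e.proj_symm_apply' hc
  simp only [Function.comp, tangentMap, ξ.reducedComp_proj hX]
  rw [hc']

/-- The reduced `k`-vector field `X̄` on the base of the principal bundle, defined by
`T proj ∘ X_a = X̄_a ∘ proj`. -/
def reduced (X : KVectorField k EP P) (hX : X.IsInvariant G) : KVectorField k EB B where
  comp := ξ.reducedComp X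
  smooth := ξ.contMDiff_reducedComp hX

/-! #### Principal connections and their curvature -/

/-- The vertical space at `p`: the kernel of `T_p proj`. -/
def vertical (p : P) : Submodule ℝ (TangentSpace 𝓘(ℝ, EP) p) :=
  LinearMap.ker (mfderiv 𝓘(ℝ, EP) 𝓘(ℝ, EB) ξ.proj p).toLinearMap

/-- A principal connection: a smooth `G`-invariant distribution complementary to the vertical
distribution. Smoothness means that every horizontal vector extends to a smooth horizontal vector
field on a neighbourhood. -/
structure PrincipalConnection where
  /-- the horizontal space at `p` -/
  horizontal : (p : P) → Submodule ℝ (TangentSpace 𝓘(ℝ, EP) p)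
  isCompl : ∀ p, IsCompl (horizontal p) (ξ.vertical p)
  smul_mem : ∀ (g : G) (p : P), ∀ v ∈ horizontal p,
    mfderiv 𝓘(ℝ, EP) 𝓘(ℝ, EP) (fun q : P => g • q) p v ∈ horizontal (g • p)
  smooth : ∀ (p : P), ∀ v ∈ horizontal p,
    ∃ (W : Set P) (Y : (q : P) → TangentSpace 𝓘(ℝ, EP) q), IsOpen W ∧ p ∈ W ∧ Y p = v ∧
      (∀ q ∈ W, Y q ∈ horizontal q) ∧
      ContMDiffOn 𝓘(ℝ, EP) 𝓘(ℝ, EP).tangent ∞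
        (fun q => (⟨q, Y q⟩ : TangentBundle 𝓘(ℝ, EP) P)) W

namespace PrincipalConnection

variable {ξ} (Γ : ξ.PrincipalConnection)

/-- The horizontal part of a vector field. -/
def hor (Y : (p : P) → TangentSpace 𝓘(ℝ, EP) p) (p : P) : TangentSpace 𝓘(ℝ, EP) p :=
  Submodule.projection (Γ.horizontal p) (ξ.vertical p) (Γ.isCompl p) (Y p)

/-- The vertical part of a vector field. -/
def ver (Y : (p : P) → TangentSpace 𝓘(ℝ, EP) p) (p : P) : TangentSpace 𝓘(ℝ, EP) p :=
  Submodule.projection (ξ.vertical p) (Γ.horizontal p) (Γ.isCompl p).symm (Y p)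

/-- The curvature `K(Y, Z) = -Ver [Hor Y, Hor Z]`. -/
def curvature (Y Z : (p : P) → TangentSpace 𝓘(ℝ, EP) p) (p : P) : TangentSpace 𝓘(ℝ, EP) p :=
  - Γ.ver (VectorField.mlieBracket 𝓘(ℝ, EP) (Γ.hor Y) (Γ.hor Z)) p

/-- A principal connection is flat if its curvature vanishes on all smooth vector fields. -/
def IsFlat : Prop :=
  ∀ Y Z : (p : P) → TangentSpace 𝓘(ℝ, EP) p,
    ContMDiff 𝓘(ℝ, EP) 𝓘(ℝ, EP).tangent ∞ (fun p => (⟨p, Y p⟩ : TangentBundle 𝓘(ℝ, EP) P)) →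
    ContMDiff 𝓘(ℝ, EP) 𝓘(ℝ, EP).tangent ∞ (fun p => (⟨p, Z p⟩ : TangentBundle 𝓘(ℝ, EP) P)) →
    ∀ p, Γ.curvature Y Z p = 0

end PrincipalConnection

/-! #### Pullback of a principal bundle along a smooth map -/

section Pullback

variable {EN : Type*} [NormedAddCommGroup EN] [NormedSpace ℝ EN]
  {N : Type*} [TopologicalSpace N] [ChartedSpace EN N] [IsManifold 𝓘(ℝ, EN) ∞ N]
  (f : C^∞⟮𝓘(ℝ, EN), N; 𝓘(ℝ, EB), B⟯)

/-- The total space `f^*P = {(n, p) ∈ N × P | f n = proj p}` of the pullback bundle. -/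
@[ext]
structure PullbackSpace where
  /-- the component in `N`: the projection `f^*P → N` -/
  base : N
  /-- the component in `P`: the projection `f^*P → P` -/
  pt : P
  f_base : f base = ξ.proj pt

namespace PullbackSpace

variable {ξ f}

/-- The inclusion `f^*P ⊂ N × P`. -/
def incl (s : ξ.PullbackSpace f) : N × P := (s.base, s.pt)

/-- `f^*P` carries the subspace topology. -/
instance : TopologicalSpace (ξ.PullbackSpace f) := TopologicalSpace.induced incl inferInstance

lemma isInducing_incl : Topology.IsInducing (incl : ξ.PullbackSpace f → N × P) := ⟨rfl⟩

lemma continuous_incl : Continuous (incl : ξ.PullbackSpace f → N × P) := isInducing_incl.continuous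

lemma continuous_base : Continuous (base : ξ.PullbackSpace f → N) :=
  continuous_fst.comp continuous_incl

lemma continuous_pt : Continuous (pt : ξ.PullbackSpace f → P) :=
  continuous_snd.comp continuous_incl

/-- The point of `f^*P` over `n` with fibre coordinate `g` in the trivialization of `P` over a
neighbourhood of `b` (and the junk value `s₀` if `f n` is outside that neighbourhood). -/
def ofTriv (b : B) (s₀ : ξ.PullbackSpace f) (x : N × G) : ξ.PullbackSpace f := by
  classical
  exact if h : f x.1 ∈ (ξ.triv b).baseSet then
    ⟨x.1, (ξ.triv b).toOpenPartialHomeomorph.symm (f x.1, x.2),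
      ((ξ.triv b).proj_symm_apply' h).symm⟩
  else s₀

lemma incl_ofTriv (b : B) (s₀ : ξ.PullbackSpace f) {x : N × G}
    (h : f x.1 ∈ (ξ.triv b).baseSet) :
    incl (ofTriv b s₀ x) = (x.1, (ξ.triv b).toOpenPartialHomeomorph.symm (f x.1, x.2)) := by
  unfold ofTriv
  rw [dif_pos h]
  rfl

lemma base_ofTriv (b : B) (s₀ : ξ.PullbackSpace f) {x : N × G}
    (h : f x.1 ∈ (ξ.triv b).baseSet) : base (ofTriv b s₀ x) = x.1 :=
  congrArg Prod.fst (incl_ofTriv b s₀ h)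

lemma pt_ofTriv (b : B) (s₀ : ξ.PullbackSpace f) {x : N × G}
    (h : f x.1 ∈ (ξ.triv b).baseSet) :
    pt (ofTriv b s₀ x) = (ξ.triv b).toOpenPartialHomeomorph.symm (f x.1, x.2) :=
  congrArg Prod.snd (incl_ofTriv b s₀ h)

/-- The local trivialization `(n, p) ↦ (n, g)` of `f^*P` induced by the trivialization
`p ↦ (proj p, g)` of `P` over a neighbourhood of `b`. -/
def triv (b : B) (s₀ : ξ.PullbackSpace f) :
    Bundle.Trivialization G (base : ξ.PullbackSpace f → N) where
  toFun s := (s.base, (ξ.triv b s.pt).2)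
  invFun := ofTriv b s₀
  source := base ⁻¹' (f ⁻¹' (ξ.triv b).baseSet)
  target := (f ⁻¹' (ξ.triv b).baseSet) ×ˢ univ
  map_source' s hs := ⟨hs, mem_univ _⟩
  map_target' x hx := by
    have h : f x.1 ∈ (ξ.triv b).baseSet := hx.1
    change f (base (ofTriv b s₀ x)) ∈ (ξ.triv b).baseSet
    rwa [base_ofTriv b s₀ h]
  left_inv' s hs := by
    have h : f s.base ∈ (ξ.triv b).baseSet := hs
    refine PullbackSpace.ext (base_ofTriv b s₀ h) ((pt_ofTriv b s₀ h).trans ?_)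
    have h' : s.pt ∈ (ξ.triv b).source := (ξ.triv b).mem_source.2 (s.f_base ▸ h)
    change (ξ.triv b).toOpenPartialHomeomorph.symm (f s.base, (ξ.triv b s.pt).2) = s.pt
    rw [s.f_base]
    exact (ξ.triv b).symm_apply_mk_proj h'
  right_inv' x hx := by
    have h : f x.1 ∈ (ξ.triv b).baseSet := hx.1
    refine Prod.ext (base_ofTriv b s₀ h) ?_
    change (ξ.triv b (pt (ofTriv b s₀ x))).2 = x.2
    rw [pt_ofTriv b s₀ h, (ξ.triv b).apply_symm_apply' h]
  open_source := ((ξ.triv b).open_baseSet.preimage f.contMDiff.continuous).preimage continuous_base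
  open_target := ((ξ.triv b).open_baseSet.preimage f.contMDiff.continuous).prod isOpen_univ
  continuousOn_toFun := by
    refine continuous_base.continuousOn.prodMk (continuous_snd.comp_continuousOn ?_)
    refine (ξ.triv b).toOpenPartialHomeomorph.continuousOn.comp continuous_pt.continuousOn fun s hs => ?_
    exact (ξ.triv b).mem_source.2 (s.f_base ▸ hs)
  continuousOn_invFun := by
    refine isInducing_incl.continuousOn_iff.2 ?_
    have h : ContinuousOn (fun x : N × G =>
        (x.1, (ξ.triv b).toOpenPartialHomeomorph.symm (f x.1, x.2)))
        ((f ⁻¹' (ξ.triv b).baseSet) ×ˢ univ) := by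
      refine continuousOn_fst.prodMk ?_
      refine (ξ.triv b).toOpenPartialHomeomorph.continuousOn_symm.comp
        (f := fun x : N × G => (f x.1, x.2)) ?_ fun x hx => ?_
      · exact ((f.contMDiff.continuous.comp continuous_fst).prodMk continuous_snd).continuousOn
      · exact (ξ.triv b).mem_target.2 hx.1
    exact h.congr fun x hx => incl_ofTriv b s₀ hx.1
  baseSet := f ⁻¹' (ξ.triv b).baseSet
  open_baseSet := (ξ.triv b).open_baseSet.preimage f.contMDiff.continuous
  source_eq := rfl
  target_eq := rfl
  proj_toFun _ _ := rfl

/-- The chart of `f^*P` around `s`: the local trivialization over a neighbourhood of `s`, followed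
by the product of charts of `N` and `G`. -/
def chart (s : ξ.PullbackSpace f) : OpenPartialHomeomorph (ξ.PullbackSpace f) (EN × EG) :=
  (triv (f s.base) s).toOpenPartialHomeomorph.trans
    ((chartAt EN s.base).prod (chartAt EG (ξ.triv (f s.base) s.pt).2))

instance : ChartedSpace (EN × EG) (ξ.PullbackSpace f) where
  atlas := range chart
  chartAt := chart
  mem_chart_source s := by
    refine ⟨ξ.mem_triv (f s.base), ?_⟩
    exact ⟨mem_chart_source EN s.base, mem_chart_source EG _⟩
  chart_mem_atlas s := ⟨s, rfl⟩

section Smooth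

variable {EM : Type*} [NormedAddCommGroup EM] [NormedSpace ℝ EM]
  {HM : Type*} [TopologicalSpace HM] {IM : ModelWithCorners ℝ EM HM}
  {M : Type*} [TopologicalSpace M] [ChartedSpace HM M]

lemma contMDiffAt_chart_comp (s : ξ.PullbackSpace f) {h : M → ξ.PullbackSpace f} {x : M}
    (hx : h x ∈ (chart s).source)
    (h₁ : ContMDiffAt IM 𝓘(ℝ, EN) ∞ (fun y => (h y).base) x)
    (h₂ : ContMDiffAt IM 𝓘(ℝ, EP) ∞ (fun y => (h y).pt) x) :
    ContMDiffAt IM 𝓘(ℝ, EN × EG) ∞ (fun y => chart s (h y)) x := by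
  obtain ⟨hx1, hx2, hx3⟩ := hx
  have hb : f (h x).base ∈ (ξ.triv (f s.base)).baseSet := hx1
  have hp : (h x).pt ∈ (ξ.triv (f s.base)).source :=
    (ξ.triv _).mem_source.2 ((h x).f_base ▸ hb)
  refine ContMDiffAt.prodMk_space (E' := EN) (F' := EG)
    (f := fun y => chartAt EN s.base (h y).base)
    (g := fun y => chartAt EG (ξ.triv (f s.base) s.pt).2 (ξ.triv (f s.base) (h y).pt).2) ?_ ?_
  · exact ((contMDiffOn_chart (I := 𝓘(ℝ, EN)) (n := ∞)).contMDiffAt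
      ((chartAt EN s.base).open_source.mem_nhds hx2)).comp x h₁
  · have h3 := ((ξ.contMDiffOn_triv (f s.base)).contMDiffAt
      ((ξ.triv (f s.base)).open_source.mem_nhds hp)).comp x h₂
    exact ((contMDiffOn_chart (I := 𝓘(ℝ, EG)) (n := ∞)).contMDiffAt
      ((chartAt EG _).open_source.mem_nhds hx3)).comp x (contMDiffAt_snd.comp x h3)

lemma contMDiffAt_ofTriv (b : B) (s₀ : ξ.PullbackSpace f) {x : N × G}
    (h : f x.1 ∈ (ξ.triv b).baseSet) :
    ContMDiffAt (𝓘(ℝ, EN).prod 𝓘(ℝ, EG)) 𝓘(ℝ, EN) ∞ (fun y => (ofTriv b s₀ y).base) x ∧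
    ContMDiffAt (𝓘(ℝ, EN).prod 𝓘(ℝ, EG)) 𝓘(ℝ, EP) ∞ (fun y => (ofTriv b s₀ y).pt) x := by
  have hev : ∀ᶠ y : N × G in 𝓝 x, f y.1 ∈ (ξ.triv b).baseSet :=
    (f.contMDiff.continuous.comp continuous_fst).continuousAt.preimage_mem_nhds
      ((ξ.triv b).open_baseSet.mem_nhds h)
  constructor
  · exact contMDiffAt_fst.congr_of_eventuallyEq (hev.mono fun y hy => base_ofTriv b s₀ hy)
  · have h1 := (ξ.contMDiffOn_triv_symm b).contMDiffAt (x := (f x.1, x.2))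
      ((ξ.triv b).open_target.mem_nhds ((ξ.triv b).mem_target.2 h))
    have h2 : ContMDiffAt (𝓘(ℝ, EN).prod 𝓘(ℝ, EG)) (𝓘(ℝ, EB).prod 𝓘(ℝ, EG)) ∞
        (fun y : N × G => (f y.1, y.2)) x :=
      (f.contMDiff.contMDiffAt.comp x contMDiffAt_fst).prodMk contMDiffAt_snd
    exact (h1.comp x h2).congr_of_eventuallyEq (hev.mono fun y hy => pt_ofTriv b s₀ hy)

lemma contMDiffAt_chart_symm (s : ξ.PullbackSpace f) {y : EN × EG} (hy : y ∈ (chart s).target) :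
    ContMDiffAt 𝓘(ℝ, EN × EG) 𝓘(ℝ, EN) ∞ (fun z => ((chart s).symm z).base) y ∧
    ContMDiffAt 𝓘(ℝ, EN × EG) 𝓘(ℝ, EP) ∞ (fun z => ((chart s).symm z).pt) y := by
  obtain ⟨⟨hy1, hy2⟩, hy3, -⟩ := hy
  have hc : ContMDiffAt 𝓘(ℝ, EN × EG) (𝓘(ℝ, EN).prod 𝓘(ℝ, EG)) ∞ (fun z : EN × EG =>
      ((chartAt EN s.base).symm z.1, (chartAt EG (ξ.triv (f s.base) s.pt).2).symm z.2)) y := by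
    refine ContMDiffAt.prodMk ?_ ?_
    · exact ((contMDiffOn_chart_symm (I := 𝓘(ℝ, EN)) (n := ∞)).contMDiffAt
        ((chartAt EN s.base).open_target.mem_nhds hy1)).comp y contDiffAt_fst.contMDiffAt
    · exact ((contMDiffOn_chart_symm (I := 𝓘(ℝ, EG)) (n := ∞)).contMDiffAt
        ((chartAt EG _).open_target.mem_nhds hy2)).comp y contDiffAt_snd.contMDiffAt
  obtain ⟨h1, h2⟩ := contMDiffAt_ofTriv (f s.base) s
    (x := ((chartAt EN s.base).symm y.1, (chartAt EG (ξ.triv (f s.base) s.pt).2).symm y.2)) hy3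
  exact ⟨ContMDiffAt.comp (g := fun x : N × G => (ofTriv (f s.base) s x).base) y h1 hc,
    ContMDiffAt.comp (g := fun x : N × G => (ofTriv (f s.base) s x).pt) y h2 hc⟩

instance : IsManifold 𝓘(ℝ, EN × EG) ∞ (ξ.PullbackSpace f) := by
  refine isManifold_of_contDiffOn _ _ _ ?_
  rintro _ _ ⟨s, rfl⟩ ⟨s', rfl⟩ y hy
  have hy' : y ∈ ((chart s).symm.trans (chart s')).source := hy.1
  obtain ⟨h1, h2⟩ := contMDiffAt_chart_symm s (y := y) hy'.1
  exact (contMDiffAt_chart_comp s' hy'.2 h1 h2).contDiffAt.contDiffWithinAt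

lemma contMDiff_base_pt :
    ContMDiff 𝓘(ℝ, EN × EG) 𝓘(ℝ, EN) ∞ (base : ξ.PullbackSpace f → N) ∧
    ContMDiff 𝓘(ℝ, EN × EG) 𝓘(ℝ, EP) ∞ (pt : ξ.PullbackSpace f → P) := by
  have hs (s : ξ.PullbackSpace f) : s ∈ (chart s).source := mem_chart_source (EN × EG) s
  have hc (s : ξ.PullbackSpace f) :
      ContMDiffAt 𝓘(ℝ, EN × EG) 𝓘(ℝ, EN × EG) ∞ (chart s) s :=
    (contMDiffOn_chart (I := 𝓘(ℝ, EN × EG)) (n := ∞) (x := s)).contMDiffAt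
      ((chart s).open_source.mem_nhds (hs s))
  have hev (s : ξ.PullbackSpace f) : ∀ᶠ z in 𝓝 s, (chart s).symm (chart s z) = z :=
    Filter.Eventually.mono ((chart s).open_source.mem_nhds (hs s)) fun z hz =>
      (chart s).left_inv hz
  constructor
  · intro s
    exact ((contMDiffAt_chart_symm s ((chart s).map_source (hs s))).1.comp s (hc s)
      ).congr_of_eventuallyEq ((hev s).mono fun z hz => (congrArg base hz).symm)
  · intro s
    exact ((contMDiffAt_chart_symm s ((chart s).map_source (hs s))).2.comp s (hc s)
      ).congr_of_eventuallyEq ((hev s).mono fun z hz => (congrArg pt hz).symm)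

lemma contMDiff_base : ContMDiff 𝓘(ℝ, EN × EG) 𝓘(ℝ, EN) ∞ (base : ξ.PullbackSpace f → N) :=
  contMDiff_base_pt.1

lemma contMDiff_pt : ContMDiff 𝓘(ℝ, EN × EG) 𝓘(ℝ, EP) ∞ (pt : ξ.PullbackSpace f → P) :=
  contMDiff_base_pt.2

lemma contMDiff_incl : ContMDiff 𝓘(ℝ, EN × EG) (𝓘(ℝ, EN).prod 𝓘(ℝ, EP)) ∞
    (incl : ξ.PullbackSpace f → N × P) :=
  contMDiff_base.prodMk contMDiff_pt

/-- A map to `f^*P` is smooth if its components in `N` and `P` are. -/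
lemma contMDiffAt_of_base_pt {h : M → ξ.PullbackSpace f} {x : M}
    (h₁ : ContMDiffAt IM 𝓘(ℝ, EN) ∞ (fun y => (h y).base) x)
    (h₂ : ContMDiffAt IM 𝓘(ℝ, EP) ∞ (fun y => (h y).pt) x) :
    ContMDiffAt IM 𝓘(ℝ, EN × EG) ∞ h x := by
  rw [contMDiffAt_iff_target]
  refine ⟨isInducing_incl.continuousAt_iff.2 (h₁.continuousAt.prodMk h₂.continuousAt), ?_⟩
  exact contMDiffAt_chart_comp (h x) (mem_chart_source (EN × EG) (h x)) h₁ h₂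

end Smooth

/-! The action `g • (n, p) = (n, g • p)` on the pullback. -/

instance : MulAction G (ξ.PullbackSpace f) where
  smul g s := ⟨s.base, g • s.pt, by rw [ξ.proj_smul, s.f_base]⟩
  one_smul s := PullbackSpace.ext rfl (one_smul G s.pt)
  mul_smul g h s := PullbackSpace.ext rfl (mul_smul g h s.pt)

instance : ContMDiffSMul 𝓘(ℝ, EG) 𝓘(ℝ, EN × EG) ∞ G (ξ.PullbackSpace f) where
  contMDiff_smul := fun x => contMDiffAt_of_base_pt
    ((contMDiff_base.comp contMDiff_snd) x)
    (((contMDiff_smul (I := 𝓘(ℝ, EG)) (I' := 𝓘(ℝ, EP)) (n := ∞) (G := G) (M := P)).comp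
      (contMDiff_fst.prodMk (contMDiff_pt.comp contMDiff_snd))) x)


end PullbackSpace

/-- The pullback bundle `f^*P → N`. -/
def pullback : PrincipalBundle EG (EN × EG) EN G
    (ξ.PullbackSpace f) N where
  proj := PullbackSpace.base
  proj_smul _ _ := rfl
  exists_trivialization n := by
    obtain ⟨p, hp⟩ := ξ.surjective_proj (f n)
    have hev (s : ξ.PullbackSpace f) (hs : s ∈ (PullbackSpace.triv (f n) ⟨n, p, hp.symm⟩).source) :
        s.pt ∈ (ξ.triv (f n)).source := by
      have : f s.base ∈ (ξ.triv (f n)).baseSet := hs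
      exact (ξ.triv _).mem_source.2 (s.f_base ▸ this)
    refine ⟨PullbackSpace.triv (f n) ⟨n, p, hp.symm⟩, ξ.mem_triv (f n), ?_, ?_, ?_⟩
    · intro s hs
      refine (ContMDiffAt.prodMk (PullbackSpace.contMDiff_base s) ?_).contMDiffWithinAt
      have h3 := ((ξ.contMDiffOn_triv (f n)).contMDiffAt
        ((ξ.triv (f n)).open_source.mem_nhds (hev s hs))).comp s (PullbackSpace.contMDiff_pt s)
      exact contMDiffAt_snd.comp s h3
    · intro x hx
      obtain ⟨h1, h2⟩ := PullbackSpace.contMDiffAt_ofTriv (f n) ⟨n, p, hp.symm⟩ (x := x) hx.1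
      exact (PullbackSpace.contMDiffAt_of_base_pt h1 h2).contMDiffWithinAt
    · intro g s hs
      refine Prod.ext rfl ?_
      have h := congrArg Prod.snd (ξ.triv_smul (f n) g ((ξ.triv _).mem_source.1 (hev s hs)))
      exact h

namespace PullbackSpace

variable {ξ f}

/-- Near `s`, the inclusion `f^*P ⊂ N × P` has the smooth left inverse `(n, p) ↦ (n, g)`, where `g`
is the fibre coordinate of `p`. -/
def retr (b : B) (s₀ : ξ.PullbackSpace f) (x : N × P) : ξ.PullbackSpace f :=
  ofTriv b s₀ (x.1, (ξ.triv b x.2).2)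

lemma retr_incl (b : B) (s₀ : ξ.PullbackSpace f) {q : ξ.PullbackSpace f}
    (h : f q.base ∈ (ξ.triv b).baseSet) : retr b s₀ (incl q) = q :=
  (triv b s₀).left_inv h

lemma contMDiffAt_retr (b : B) (s₀ : ξ.PullbackSpace f) {x : N × P}
    (h₁ : f x.1 ∈ (ξ.triv b).baseSet) (h₂ : ξ.proj x.2 ∈ (ξ.triv b).baseSet) :
    ContMDiffAt (𝓘(ℝ, EN).prod 𝓘(ℝ, EP)) 𝓘(ℝ, EN × EG) ∞ (retr b s₀) x := by
  have h3 := ((ξ.contMDiffOn_triv b).contMDiffAt ((ξ.triv b).open_source.mem_nhds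
    ((ξ.triv b).mem_source.2 h₂))).comp x
    (contMDiffAt_snd (I := 𝓘(ℝ, EN)) (J := 𝓘(ℝ, EP)))
  have h4 : ContMDiffAt (𝓘(ℝ, EN).prod 𝓘(ℝ, EP)) (𝓘(ℝ, EN).prod 𝓘(ℝ, EG)) ∞
      (fun y : N × P => (y.1, (ξ.triv b y.2).2)) x :=
    contMDiffAt_fst.prodMk (contMDiffAt_snd.comp x h3)
  obtain ⟨h5, h6⟩ := contMDiffAt_ofTriv b s₀ (x := (x.1, (ξ.triv b x.2).2)) h₁
  exact ContMDiffAt.comp (g := ofTriv b s₀) x (contMDiffAt_of_base_pt h5 h6) h4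

lemma mdifferentiableAt_base (s : ξ.PullbackSpace f) :
    MDifferentiableAt 𝓘(ℝ, EN × EG) 𝓘(ℝ, EN) (base : ξ.PullbackSpace f → N) s :=
  contMDiff_base.mdifferentiable (by simp) s

lemma mdifferentiableAt_pt (s : ξ.PullbackSpace f) :
    MDifferentiableAt 𝓘(ℝ, EN × EG) 𝓘(ℝ, EP) (pt : ξ.PullbackSpace f → P) s :=
  contMDiff_pt.mdifferentiable (by simp) s

lemma mfderiv_incl_apply (s : ξ.PullbackSpace f) (v : EN × EG) :
    (mfderiv 𝓘(ℝ, EN × EG) (𝓘(ℝ, EN).prod 𝓘(ℝ, EP)) (incl : ξ.PullbackSpace f → N × P) s v :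
      EN × EP) =
      (mfderiv 𝓘(ℝ, EN × EG) 𝓘(ℝ, EN) (base : ξ.PullbackSpace f → N) s v,
        mfderiv 𝓘(ℝ, EN × EG) 𝓘(ℝ, EP) (pt : ξ.PullbackSpace f → P) s v) := by
  have h := mfderiv_prodMk (mdifferentiableAt_base s) (mdifferentiableAt_pt s)
  exact congrArg (fun L : EN × EG →L[ℝ] EN × EP => L v) h

lemma mfderiv_incl_injective (s : ξ.PullbackSpace f) {v : EN × EG}
    (hv : (mfderiv 𝓘(ℝ, EN × EG) (𝓘(ℝ, EN).prod 𝓘(ℝ, EP)) incl s v : EN × EP) = 0) : v = 0 := by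
  have hb := ξ.mem_triv (f s.base)
  have h1 : MDifferentiableAt (𝓘(ℝ, EN).prod 𝓘(ℝ, EP)) 𝓘(ℝ, EN × EG)
      (retr (f s.base) s) (incl s) :=
    (contMDiffAt_retr (f s.base) s (x := incl s) hb (s.f_base ▸ hb)).mdifferentiableAt (by simp)
  have h2 := mfderiv_comp s h1 (contMDiff_incl.mdifferentiable (by simp) s)
  have hev : ∀ᶠ q : ξ.PullbackSpace f in 𝓝 s, (retr (f s.base) s ∘ incl) q = id q :=
    Filter.Eventually.mono ((triv (f s.base) s).open_source.mem_nhds hb)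
      fun q hq => retr_incl (f s.base) s hq
  have h3 : HasMFDerivAt 𝓘(ℝ, EN × EG) 𝓘(ℝ, EN × EG) (retr (f s.base) s ∘ incl) s
      (ContinuousLinearMap.id ℝ (EN × EG)) := (hasMFDerivAt_id s).congr_of_eventuallyEq hev
  rw [h3.mfderiv] at h2
  have h4 := congrArg (fun L : EN × EG →L[ℝ] EN × EG => L v) h2
  refine h4.trans ?_
  change (mfderiv (𝓘(ℝ, EN).prod 𝓘(ℝ, EP)) 𝓘(ℝ, EN × EG) (retr (f s.base) s) (incl s) :
    EN × EP →L[ℝ] EN × EG) (mfderiv 𝓘(ℝ, EN × EG) (𝓘(ℝ, EN).prod 𝓘(ℝ, EP)) incl s v : EN × EP) = 0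
  rw [hv]
  exact map_zero _

/-- The differential of the left inverse `retr` sends a pair `(v, w)` with `Tf v = T proj w` to a
tangent vector of `f^*P` with components `v` and `w`. -/
lemma mfderiv_retr (b : B) (s₀ : ξ.PullbackSpace f) {q : ξ.PullbackSpace f}
    (hq : f q.base ∈ (ξ.triv b).baseSet) (v : EN) (w : EP)
    (h : (mfderiv 𝓘(ℝ, EN) 𝓘(ℝ, EB) f q.base v : EB) =
      mfderiv 𝓘(ℝ, EP) 𝓘(ℝ, EB) ξ.proj q.pt w) {u : EN × EG}
    (hu : u = (mfderiv (𝓘(ℝ, EN).prod 𝓘(ℝ, EP)) 𝓘(ℝ, EN × EG) (retr b s₀) (incl q) :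
      EN × EP →L[ℝ] EN × EG) (v, w)) :
    (mfderiv 𝓘(ℝ, EN × EG) 𝓘(ℝ, EN) base q u : EN) = v ∧
    (mfderiv 𝓘(ℝ, EN × EG) 𝓘(ℝ, EP) pt q u : EP) = w := by
  have hq' : ξ.proj q.pt ∈ (ξ.triv b).baseSet := q.f_base ▸ hq
  have hret : MDifferentiableAt (𝓘(ℝ, EN).prod 𝓘(ℝ, EP)) 𝓘(ℝ, EN × EG) (retr b s₀) (incl q) :=
    (contMDiffAt_retr b s₀ (x := incl q) hq hq').mdifferentiableAt (by simp)
  have hev : ∀ᶠ x : N × P in 𝓝 (incl q), f x.1 ∈ (ξ.triv b).baseSet :=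
    (f.contMDiff.continuous.comp continuous_fst).continuousAt.preimage_mem_nhds
      ((ξ.triv b).open_baseSet.mem_nhds hq)
  have hq0 := retr_incl b s₀ hq
  constructor
  · have h1 : MDifferentiableAt 𝓘(ℝ, EN × EG) 𝓘(ℝ, EN) (base : ξ.PullbackSpace f → N)
        (retr b s₀ (incl q)) := mdifferentiableAt_base _
    have h2 := mfderiv_comp (incl q) h1 hret
    have h3 : HasMFDerivAt (𝓘(ℝ, EN).prod 𝓘(ℝ, EP)) 𝓘(ℝ, EN) (base ∘ retr b s₀) (incl q)
        (ContinuousLinearMap.fst ℝ EN EP) :=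
      (hasMFDerivAt_fst (incl q)).congr_of_eventuallyEq
        (hev.mono fun x hx => base_ofTriv b s₀ hx)
    rw [h3.mfderiv] at h2
    have h4 := congrArg (fun L : EN × EP →L[ℝ] EN => L (v, w)) h2
    rw [hq0] at h4
    rw [hu]
    exact h4.symm
  · set e := ξ.triv b with he
    have hs : q.pt ∈ e.source := e.mem_source.2 hq'
    have heq : (ξ.proj q.pt, (e q.pt).2) = (f q.base, (e q.pt).2) := by rw [q.f_base]
    -- the fibre coordinate
    have hθ : MDifferentiableAt (𝓘(ℝ, EN).prod 𝓘(ℝ, EP)) 𝓘(ℝ, EG)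
        (fun x : N × P => (e x.2).2) (incl q) :=
      (contMDiffAt_snd.comp (incl q) (((ξ.contMDiffOn_triv b).contMDiffAt
        (e.open_source.mem_nhds hs)).comp (incl q) contMDiffAt_snd)).mdifferentiableAt (by simp)
    have hf₁ : MDifferentiableAt 𝓘(ℝ, EN) 𝓘(ℝ, EB) f q.base :=
      f.contMDiff.mdifferentiable (by simp) _
    have hf₂ : MDifferentiableAt 𝓘(ℝ, EP) 𝓘(ℝ, EB) ξ.proj q.pt :=
      ξ.contMDiff_proj.mdifferentiable (by simp) _
    have hf₁' : HasMFDerivAt (𝓘(ℝ, EN).prod 𝓘(ℝ, EP)) 𝓘(ℝ, EB) (fun x : N × P => f x.1) (incl q)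
        ((mfderiv 𝓘(ℝ, EN) 𝓘(ℝ, EB) f q.base).comp (ContinuousLinearMap.fst ℝ EN EP)) :=
      HasMFDerivAt.comp (incl q) hf₁.hasMFDerivAt (hasMFDerivAt_fst (incl q))
    have hf₂' : HasMFDerivAt (𝓘(ℝ, EN).prod 𝓘(ℝ, EP)) 𝓘(ℝ, EB) (fun x : N × P => ξ.proj x.2)
        (incl q)
        ((mfderiv 𝓘(ℝ, EP) 𝓘(ℝ, EB) ξ.proj q.pt).comp (ContinuousLinearMap.snd ℝ EN EP)) :=
      HasMFDerivAt.comp (incl q) hf₂.hasMFDerivAt (hasMFDerivAt_snd (incl q))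
    have hκ₁ := hf₁'.prodMk hθ.hasMFDerivAt
    have hκ₂ := hf₂'.prodMk hθ.hasMFDerivAt
    have hS₁ : MDifferentiableAt (𝓘(ℝ, EB).prod 𝓘(ℝ, EG)) 𝓘(ℝ, EP)
        e.toOpenPartialHomeomorph.symm (f q.base, (e q.pt).2) :=
      ((ξ.contMDiffOn_triv_symm b).contMDiffAt
        (e.open_target.mem_nhds (e.mem_target.2 hq))).mdifferentiableAt (by simp)
    have hS₂ : HasMFDerivAt (𝓘(ℝ, EB).prod 𝓘(ℝ, EG)) 𝓘(ℝ, EP)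
        e.toOpenPartialHomeomorph.symm (ξ.proj q.pt, (e q.pt).2)
        (mfderiv (𝓘(ℝ, EB).prod 𝓘(ℝ, EG)) 𝓘(ℝ, EP)
          e.toOpenPartialHomeomorph.symm (f q.base, (e q.pt).2) : EB × EG →L[ℝ] EP) := by
      rw [heq]; exact hS₁.hasMFDerivAt
    have h1 := HasMFDerivAt.comp (incl q) hS₁.hasMFDerivAt hκ₁
    have h2 := HasMFDerivAt.comp (incl q) hS₂ hκ₂
    -- both compositions are known near `incl q`
    have h3 : HasMFDerivAt (𝓘(ℝ, EN).prod 𝓘(ℝ, EP)) 𝓘(ℝ, EP) (pt ∘ retr b s₀) (incl q) _ :=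
      h1.congr_of_eventuallyEq (hev.mono fun x hx => pt_ofTriv b s₀ hx)
    have hev₂ : ∀ᶠ x : N × P in 𝓝 (incl q), x.2 ∈ e.source :=
      continuous_snd.continuousAt.preimage_mem_nhds (e.open_source.mem_nhds hs)
    have h4 := (hasMFDerivAt_snd (I := 𝓘(ℝ, EN)) (I' := 𝓘(ℝ, EP)) (incl q)).congr_of_eventuallyEq
      (hev₂.mono fun x hx => e.symm_apply_mk_proj hx)
    have h5 := congrArg (fun L : EN × EP →L[ℝ] EP => L (v, w)) (hasMFDerivAt_unique h2 h4)
    have h6 : MDifferentiableAt 𝓘(ℝ, EN × EG) 𝓘(ℝ, EP) (pt : ξ.PullbackSpace f → P)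
        (retr b s₀ (incl q)) := mdifferentiableAt_pt _
    have h7 := congrArg (fun L : EN × EP →L[ℝ] EP => L (v, w))
      (hasMFDerivAt_unique h3 (HasMFDerivAt.comp (incl q) h6.hasMFDerivAt hret.hasMFDerivAt))
    rw [hq0] at h7
    rw [hu]
    refine h7.symm.trans (Eq.trans ?_ h5)
    exact congrArg (fun z : EB => (mfderiv (𝓘(ℝ, EB).prod 𝓘(ℝ, EG)) 𝓘(ℝ, EP)
      e.toOpenPartialHomeomorph.symm (f q.base, (e q.pt).2) : EB × EG →L[ℝ] EP)
        (z, (mfderiv (𝓘(ℝ, EN).prod 𝓘(ℝ, EP)) 𝓘(ℝ, EG)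
          (fun x : N × P => (e x.2).2) (incl q) : EN × EP →L[ℝ] EG) (v, w))) h

/-- Smooth vector fields `A` on `N` and `C` on `P` with `Tf A = T proj C` along `f^*P` combine,
locally, to a smooth vector field on `f^*P`. -/
lemma exists_vectorField (A : (n : N) → TangentSpace 𝓘(ℝ, EN) n)
    (C : (p : P) → TangentSpace 𝓘(ℝ, EP) p)
    (hA : ContMDiff 𝓘(ℝ, EN) 𝓘(ℝ, EN).tangent ∞
      (fun n => (⟨n, A n⟩ : TangentBundle 𝓘(ℝ, EN) N)))
    (hC : ContMDiff 𝓘(ℝ, EP) 𝓘(ℝ, EP).tangent ∞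
      (fun p => (⟨p, C p⟩ : TangentBundle 𝓘(ℝ, EP) P)))
    (h : ∀ q : ξ.PullbackSpace f, (mfderiv 𝓘(ℝ, EN) 𝓘(ℝ, EB) f q.base (A q.base) : EB) =
      mfderiv 𝓘(ℝ, EP) 𝓘(ℝ, EB) ξ.proj q.pt (C q.pt))
    (s : ξ.PullbackSpace f) :
    ∃ (W : Set (ξ.PullbackSpace f)) (Y : (q : ξ.PullbackSpace f) → TangentSpace 𝓘(ℝ, EN × EG) q),
      IsOpen W ∧ s ∈ W ∧
      ContMDiffOn 𝓘(ℝ, EN × EG) 𝓘(ℝ, EN × EG).tangent ∞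
        (fun q => (⟨q, Y q⟩ : TangentBundle 𝓘(ℝ, EN × EG) (ξ.PullbackSpace f))) W ∧
      ∀ q ∈ W, mfderiv 𝓘(ℝ, EN × EG) 𝓘(ℝ, EN) base q (Y q) = A q.base ∧
        mfderiv 𝓘(ℝ, EN × EG) 𝓘(ℝ, EP) pt q (Y q) = C q.pt := by
  set b := f s.base with hb
  refine ⟨(triv b s).source, fun q => (mfderiv (𝓘(ℝ, EN).prod 𝓘(ℝ, EP)) 𝓘(ℝ, EN × EG)
    (retr b s) (incl q) : EN × EP →L[ℝ] EN × EG) (A q.base, C q.pt), (triv b s).open_source,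
    ξ.mem_triv b, ?_, fun q hq => mfderiv_retr b s hq _ _ (h q) rfl⟩
  -- the open set on which the left inverse is smooth
  set O : Set (N × P) := {x | f x.1 ∈ (ξ.triv b).baseSet ∧ ξ.proj x.2 ∈ (ξ.triv b).baseSet}
  have hO : IsOpen O :=
    (((ξ.triv b).open_baseSet.preimage f.contMDiff.continuous).preimage continuous_fst).inter
      (((ξ.triv b).open_baseSet.preimage ξ.contMDiff_proj.continuous).preimage continuous_snd)
  have hr : ContMDiffOn (𝓘(ℝ, EN).prod 𝓘(ℝ, EP)) 𝓘(ℝ, EN × EG) ∞ (retr b s) O :=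
    fun x hx => (contMDiffAt_retr b s hx.1 hx.2).contMDiffWithinAt
  have hT := hr.contMDiffOn_tangentMapWithin (m := ∞) (by simp) hO.uniqueMDiffOn
  have hpair : ContMDiff 𝓘(ℝ, EN × EG) (𝓘(ℝ, EN).prod 𝓘(ℝ, EP)).tangent ∞
      (fun q : ξ.PullbackSpace f => (⟨incl q, (A q.base, C q.pt)⟩ :
        TangentBundle (𝓘(ℝ, EN).prod 𝓘(ℝ, EP)) (N × P))) :=
    (contMDiff_equivTangentBundleProd_symm (I := 𝓘(ℝ, EN)) (I' := 𝓘(ℝ, EP)) (M := N)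
      (M' := P)).comp ((hA.comp contMDiff_base).prodMk (hC.comp contMDiff_pt))
  have hmem : ∀ q ∈ (triv b s).source, incl q ∈ O := fun q hq => by
    have hq' : f q.base ∈ (ξ.triv b).baseSet := hq
    exact ⟨hq', q.f_base ▸ hq'⟩
  refine (hT.comp hpair.contMDiffOn (s := (triv b s).source) hmem).congr fun q hq => ?_
  simp only [Function.comp, tangentMapWithin]
  rw [mfderivWithin_of_isOpen hO (hmem q hq), retr_incl b s hq]

end PullbackSpace

end Pullback

/-! #### The connection induced by an invariant `k`-vector field -/

section InducedConnection

lemma clm_sum_smul {E F : Type*} [NormedAddCommGroup E] [NormedSpace ℝ E] [NormedAddCommGroup F]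
    [NormedSpace ℝ F] (L : E →L[ℝ] F) (c : Fin k → ℝ) {x : Fin k → E} {y : Fin k → F}
    (h : ∀ a, L (x a) = y a) : L (∑ a, c a • x a) = ∑ a, c a • y a := by
  rw [map_sum]
  exact Finset.sum_congr rfl fun a _ => by rw [map_smul, h]

lemma sum_smul_dt (v : Fin k → ℝ) : ∑ a, v a • (dt a : EuclideanSpace ℝ (Fin k)) =
    WithLp.toLp 2 v := by
  ext b
  simp [Pi.single_apply]


variable {U : TopologicalSpace.Opens (EuclideanSpace ℝ (Fin k))}
  (X : KVectorField k EP P)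
  (φ : C^∞⟮𝓘(ℝ, EuclideanSpace ℝ (Fin k)), U; 𝓘(ℝ, EB), B⟯)

/-- The distribution on `φ^*P ⊂ U × P` that is the restriction to `φ^*P` of the distribution on
`U × P` spanned by the vector fields `∂/∂tᵃ + X_a`. -/
def inducedHorizontal (s : ξ.PullbackSpace φ) :
    Submodule ℝ (TangentSpace 𝓘(ℝ, EuclideanSpace ℝ (Fin k) × EG) s) :=
  Submodule.comap
    (mfderiv 𝓘(ℝ, EuclideanSpace ℝ (Fin k) × EG)
      (𝓘(ℝ, EuclideanSpace ℝ (Fin k)).prod 𝓘(ℝ, EP)) PullbackSpace.incl s).toLinearMap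
    (Submodule.span ℝ (range fun a : Fin k =>
      ((dt a, X.comp a s.pt) : EuclideanSpace ℝ (Fin k) × EP)))

lemma mem_inducedHorizontal {s : ξ.PullbackSpace φ} {v : EuclideanSpace ℝ (Fin k) × EG} :
    v ∈ ξ.inducedHorizontal X φ s ↔ ∃ c : Fin k → ℝ,
      (mfderiv 𝓘(ℝ, EuclideanSpace ℝ (Fin k) × EG) 𝓘(ℝ, EuclideanSpace ℝ (Fin k))
        (PullbackSpace.base : ξ.PullbackSpace φ → U) s v : EuclideanSpace ℝ (Fin k)) =
          ∑ a, c a • dt a ∧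
      (mfderiv 𝓘(ℝ, EuclideanSpace ℝ (Fin k) × EG) 𝓘(ℝ, EP)
        (PullbackSpace.pt : ξ.PullbackSpace φ → P) s v : EP) =
          ∑ a, c a • (X.comp a s.pt : EP) := by
  have h : v ∈ ξ.inducedHorizontal X φ s ↔
      ((mfderiv 𝓘(ℝ, EuclideanSpace ℝ (Fin k) × EG) 𝓘(ℝ, EuclideanSpace ℝ (Fin k))
        (PullbackSpace.base : ξ.PullbackSpace φ → U) s v,
        mfderiv 𝓘(ℝ, EuclideanSpace ℝ (Fin k) × EG) 𝓘(ℝ, EP)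
        (PullbackSpace.pt : ξ.PullbackSpace φ → P) s v) : EuclideanSpace ℝ (Fin k) × EP) ∈
      (Submodule.span ℝ (range fun a : Fin k =>
        ((dt a, X.comp a s.pt) : EuclideanSpace ℝ (Fin k) × EP))) := by
    exact iff_of_eq (congrArg (fun z : EuclideanSpace ℝ (Fin k) × EP => z ∈
      Submodule.span ℝ (range fun a : Fin k =>
        ((dt a, X.comp a s.pt) : EuclideanSpace ℝ (Fin k) × EP)))
      (PullbackSpace.mfderiv_incl_apply s v))
  rw [h, Submodule.mem_span_range_iff_exists_fun]
  refine exists_congr fun c => ?_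
  rw [Prod.ext_iff, Prod.fst_sum, Prod.snd_sum]
  exact and_congr eq_comm eq_comm

/-- A vector in `ℝᵏ` and the corresponding linear combination of the fields `X_a` are components of
a smooth horizontal vector field near every point of `φ^*P`. -/
lemma exists_horizontal_vectorField (hX : X.IsInvariant G) (hφ : (ξ.reduced X hX).IsIntegralSection φ)
    (c : Fin k → ℝ) (s : ξ.PullbackSpace φ) :
    ∃ (W : Set (ξ.PullbackSpace φ))
      (Y : (q : ξ.PullbackSpace φ) → TangentSpace 𝓘(ℝ, EuclideanSpace ℝ (Fin k) × EG) q),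
      IsOpen W ∧ s ∈ W ∧
      ContMDiffOn 𝓘(ℝ, EuclideanSpace ℝ (Fin k) × EG)
        𝓘(ℝ, EuclideanSpace ℝ (Fin k) × EG).tangent ∞ (fun q => (⟨q, Y q⟩ :
          TangentBundle 𝓘(ℝ, EuclideanSpace ℝ (Fin k) × EG) (ξ.PullbackSpace φ))) W ∧
      ∀ q ∈ W, (mfderiv 𝓘(ℝ, EuclideanSpace ℝ (Fin k) × EG) 𝓘(ℝ, EuclideanSpace ℝ (Fin k))
        (PullbackSpace.base : ξ.PullbackSpace φ → U) q (Y q) : EuclideanSpace ℝ (Fin k)) =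
          ∑ a, c a • dt a ∧
        (mfderiv 𝓘(ℝ, EuclideanSpace ℝ (Fin k) × EG) 𝓘(ℝ, EP)
          (PullbackSpace.pt : ξ.PullbackSpace φ → P) q (Y q) : EP) =
          ∑ a, c a • (X.comp a q.pt : EP) := by
  refine PullbackSpace.exists_vectorField
    (A := fun _ => (∑ a, c a • dt a : EuclideanSpace ℝ (Fin k)))
    (C := fun p => ∑ a, c a • X.comp a p) (contMDiff_opens_const _) ?_ ?_ s
  · refine ContMDiff.sum_section (t := fun a p => c a • X.comp a p) fun a _ => ?_
    exact (X.smooth a).const_smul_section (a := c a)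
  · intro q
    have h1 := clm_sum_smul (E := EuclideanSpace ℝ (Fin k)) (F := EB)
      (mfderiv 𝓘(ℝ, EuclideanSpace ℝ (Fin k)) 𝓘(ℝ, EB) φ q.base) c (x := dt)
      (y := fun a => ξ.reducedComp X a (φ q.base))
      (hφ.2 q.base)
    have h2 := clm_sum_smul (E := EP) (F := EB)
      (mfderiv 𝓘(ℝ, EP) 𝓘(ℝ, EB) ξ.proj q.pt) c (x := fun a => X.comp a q.pt)
      (y := fun a => ξ.reducedComp X a (ξ.proj q.pt))
      (fun a => ξ.reducedComp_proj hX a q.pt)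
    rw [← q.f_base] at h2
    exact h1.trans h2.symm

lemma sum_smul_dt_eq_zero {c : Fin k → ℝ}
    (h : ∑ a, c a • (dt a : EuclideanSpace ℝ (Fin k)) = 0) (a : Fin k) : c a = 0 := by
  rw [sum_smul_dt] at h
  exact congrArg (fun v : EuclideanSpace ℝ (Fin k) => v a) h

/-- The principal connection `H(X, φ)` on the pullback `φ^*P → U` of the principal bundle along an
integral section `φ : U → B` of the reduced `k`-vector field. -/
def inducedConnection (hX : X.IsInvariant G) (hφ : (ξ.reduced X hX).IsIntegralSection φ) :
    (ξ.pullback φ).PrincipalConnection where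
  horizontal := ξ.inducedHorizontal X φ
  isCompl s := by
    rw [isCompl_iff, disjoint_iff_inf_le, codisjoint_iff_le_sup]
    constructor
    · rintro v ⟨hv₁, hv₂⟩
      obtain ⟨c, hc₁, hc₂⟩ := (ξ.mem_inducedHorizontal X φ).1 hv₁
      have hv₃ : (mfderiv 𝓘(ℝ, EuclideanSpace ℝ (Fin k) × EG) 𝓘(ℝ, EuclideanSpace ℝ (Fin k))
          (PullbackSpace.base : ξ.PullbackSpace φ → U) s v : EuclideanSpace ℝ (Fin k)) = 0 := hv₂
      have hc : ∀ a, c a = 0 := sum_smul_dt_eq_zero (hc₁.symm.trans hv₃)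
      refine PullbackSpace.mfderiv_incl_injective s
        ((PullbackSpace.mfderiv_incl_apply s v).trans (Prod.ext hv₃ (hc₂.trans ?_)))
      exact Finset.sum_eq_zero fun a _ => by rw [hc a, zero_smul]
    · intro v _
      obtain ⟨W, Y, -, hs, -, hW⟩ := ξ.exists_horizontal_vectorField X φ hX hφ
        (fun a => WithLp.ofLp (show EuclideanSpace ℝ (Fin k) from
          mfderiv 𝓘(ℝ, EuclideanSpace ℝ (Fin k) × EG) 𝓘(ℝ, EuclideanSpace ℝ (Fin k))
          (PullbackSpace.base : ξ.PullbackSpace φ → U) s v) a) s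
      obtain ⟨h₁, h₂⟩ := hW s hs
      refine Submodule.mem_sup.2 ⟨Y s, (ξ.mem_inducedHorizontal X φ).2 ⟨_, h₁, h₂⟩, v - Y s, ?_,
        add_sub_cancel _ _⟩
      have h₃ := sub_eq_zero.2 (h₁.trans (sum_smul_dt _)).symm
      exact (map_sub (mfderiv 𝓘(ℝ, EuclideanSpace ℝ (Fin k) × EG) 𝓘(ℝ, EuclideanSpace ℝ (Fin k))
          (PullbackSpace.base : ξ.PullbackSpace φ → U) s) v (Y s)).trans h₃
  smul_mem g s v hv := by
    obtain ⟨c, hc₁, hc₂⟩ := (ξ.mem_inducedHorizontal X φ).1 hv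
    have hg : MDifferentiableAt 𝓘(ℝ, EuclideanSpace ℝ (Fin k) × EG)
        𝓘(ℝ, EuclideanSpace ℝ (Fin k) × EG) (fun q : ξ.PullbackSpace φ => g • q) s :=
      (contMDiff_smul_left EG g).mdifferentiable (by simp) s
    refine (ξ.mem_inducedHorizontal X φ).2 ⟨c, ?_, ?_⟩
    · have h := mfderiv_comp s (PullbackSpace.mdifferentiableAt_base (g • s)) hg
      have h' := congrArg (fun L : EuclideanSpace ℝ (Fin k) × EG →L[ℝ]
        EuclideanSpace ℝ (Fin k) => L v) h
      exact h'.symm.trans hc₁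
    · have h := mfderiv_comp s (PullbackSpace.mdifferentiableAt_pt (g • s)) hg
      have h' := congrArg (fun L : EuclideanSpace ℝ (Fin k) × EG →L[ℝ] EP => L v) h
      have hgP : MDifferentiableAt 𝓘(ℝ, EP) 𝓘(ℝ, EP) (fun p : P => g • p) s.pt :=
        (contMDiff_smul_left EG g).mdifferentiable (by simp) s.pt
      have k₀ := mfderiv_comp s hgP (PullbackSpace.mdifferentiableAt_pt s)
      have k' := congrArg (fun L : EuclideanSpace ℝ (Fin k) × EG →L[ℝ] EP => L v) k₀
      refine h'.symm.trans (k'.trans ?_)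
      have h₃ := clm_sum_smul (E := EP) (F := EP)
        (mfderiv 𝓘(ℝ, EP) 𝓘(ℝ, EP) (fun p : P => g • p) s.pt) c (x := fun a => X.comp a s.pt)
        (y := fun a => X.comp a (g • s.pt))
        (fun a => hX g a s.pt)
      exact (congrArg (fun z : EP =>
        (mfderiv 𝓘(ℝ, EP) 𝓘(ℝ, EP) (fun p : P => g • p) s.pt : EP →L[ℝ] EP) z) hc₂).trans h₃
  smooth s v hv := by
    obtain ⟨c, hc₁, hc₂⟩ := (ξ.mem_inducedHorizontal X φ).1 hv
    obtain ⟨W, Y, hWo, hs, hY, hW⟩ := ξ.exists_horizontal_vectorField X φ hX hφ c s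
    refine ⟨W, Y, hWo, hs, ?_, fun q hq => (ξ.mem_inducedHorizontal X φ).2 ⟨c, hW q hq⟩, hY⟩
    obtain ⟨h₁, h₂⟩ := hW s hs
    refine sub_eq_zero.1 (PullbackSpace.mfderiv_incl_injective s ?_)
    refine (map_sub (mfderiv 𝓘(ℝ, EuclideanSpace ℝ (Fin k) × EG)
      (𝓘(ℝ, EuclideanSpace ℝ (Fin k)).prod 𝓘(ℝ, EP))
      (PullbackSpace.incl : ξ.PullbackSpace φ → U × P) s) (Y s) v).trans (sub_eq_zero.2 ?_)
    refine (PullbackSpace.mfderiv_incl_apply s (Y s)).trans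
      (Eq.trans ?_ (PullbackSpace.mfderiv_incl_apply s v).symm)
    exact Prod.ext (h₁.trans hc₁.symm) (h₂.trans hc₂.symm)

end InducedConnection

end PrincipalBundle

end PrincipalBundle

end

/-! Both sides of the equivalence reduce to the vanishing of the brackets `[X_a, X_b]`.

First, a `k`-vector field is integrable if and only if its components commute
(`KVectorField.isIntegrable_iff_mlieBracket_eq_zero`). An integral section relates the commuting
fields `∂/∂tᵃ` to the `X_a`, and brackets of related fields are related
(`mfderiv_mlieBracket_of_related`). Conversely, in a chart an integral section is a solution of `Dψ
= A(ψ)`, where `A(x)v = ∑ v_a X_a(x)`. It is built by solving `γ' = A(γ)t` along each ray and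
setting `ψ(t) = γ(1)`; commutativity makes the derivative of `ψ` equal to `A(ψ)`
(`norm_radial_solution_sub_le`, `exists_solution_total_differential_equation`).

Second, on `φ^*P` the lifted fields `Z_a = ∂/∂tᵃ + X_a` are related to `∂/∂tᵃ` by the projection to
`U` and to `X_a` by the projection to `P`. Hence `[Z_a, Z_b]` is vertical, with image `[X_a, X_b]`
in `P`. Horizontal fields are combinations of the `Z_a` with function coefficients, so the curvature
vanishes exactly when the `X_a` commute over the image of `φ`
(`PrincipalBundle.isFlat_inducedConnection_iff`).

If `X` is integrable, its integral sections project to the base and all these brackets vanish. If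
the reduced field is integrable, every `p` lies over the image of some `φ`, so flatness for all `φ`
gives `[X_a, X_b] = 0` at every point of `P`. -/

noncomputable section

/-! ### Total differential equations with commuting right-hand side -/

section TotalDifferentialEquation

open Metric
open scoped NNReal

variable {F : Type*} [NormedAddCommGroup F] [NormedSpace ℝ F]
  {E : Type*} [NormedAddCommGroup E] [NormedSpace ℝ E]

/-- The solutions of the ordinary differential equations `γ' = A(γ) t` exist on `[0, 1]` for small
parameters `t`, and stay in a given ball. -/
lemma exists_radial_solution [CompleteSpace E] {A : E → F →L[ℝ] E} {x₀ : E} {ρ : ℝ} {C : ℝ≥0}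
    {t : F} (hbound : ∀ x ∈ closedBall x₀ ρ, ‖A x‖ ≤ C)
    (hlip : LipschitzOnWith C A (closedBall x₀ ρ)) (ht : C * ‖t‖ ≤ ρ) :
    ∃ γ : ℝ → E, γ 0 = x₀ ∧ (∀ r, γ r ∈ closedBall x₀ (C * ‖t‖)) ∧
      ∀ r ∈ Icc (0 : ℝ) 1, HasDerivWithinAt γ (A (γ r) t) (Icc 0 1) r := by
  have hsub : closedBall x₀ (C * ‖t‖) ⊆ closedBall x₀ ρ := closedBall_subset_closedBall ht
  let t₀ : Icc (0 : ℝ) 1 := ⟨0, by simp⟩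
  -- On the time interval `[0, 1]` the speed bound `C‖t‖` is exactly the radius needed, so the
  -- solution exists on the whole interval and not just for short time.
  have hf : IsPicardLindelof (fun _ x => A x t) t₀ x₀ (C * ‖t‖₊) 0 (C * ‖t‖₊) (C * ‖t‖₊) := by
    refine ⟨fun _ _ => ?_, fun x _ => continuousOn_const, fun _ _ x hx => ?_, ?_⟩
    · refine LipschitzOnWith.of_dist_le_mul fun x hx y hy => ?_
      have h := hlip.dist_le_mul x (hsub hx) y (hsub hy)
      rw [dist_eq_norm] at h ⊢
      calc ‖A x t - A y t‖ = ‖(A x - A y) t‖ := rfl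
        _ ≤ ‖A x - A y‖ * ‖t‖ := (A x - A y).le_opNorm t
        _ ≤ (C * dist x y) * ‖t‖ := by gcongr
        _ = _ := by push_cast; ring
    · have h := hbound x (hsub hx)
      calc ‖A x t‖ ≤ ‖A x‖ * ‖t‖ := (A x).le_opNorm t
        _ ≤ C * ‖t‖ := by gcongr
        _ = _ := by push_cast; rfl
    · simp [t₀]
  have hx : x₀ ∈ closedBall x₀ ((0 : ℝ≥0) : ℝ) := mem_closedBall_self le_rfl
  -- The fixed point of the Picard map, unlike a bare existence statement, also carries confinement
  -- to the ball; its extension beyond `[0, 1]` is constant on each side, so confinement holds for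
  -- every real `r`.
  obtain ⟨α, hα⟩ := ODE.FunSpace.exists_isFixedPt_next hf hx
  refine ⟨α.compProj, ?_, fun r => ?_, fun r hr => ?_⟩
  · have h := ODE.FunSpace.compProj_val (α := α) (t := t₀)
    exact h.trans (by rw [← hα, ODE.FunSpace.next_apply₀])
  · have h := α.compProj_mem_closedBall (t := r) hf.mul_max_le
    simpa using h
  · refine (ODE.hasDerivWithinAt_picard_Icc t₀.2 hf.continuousOn_uncurry
      α.continuous_compProj.continuousOn (fun _ _ => α.compProj_mem_closedBall hf.mul_max_le)
      x₀ hr).congr_of_mem (fun r' hr' => ?_) hr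
    nth_rw 1 [← hα]
    rw [ODE.FunSpace.compProj_of_mem hr', ODE.FunSpace.next_apply]

lemma gronwallBound_zero_left (K ε x : ℝ) :
    gronwallBound 0 K ε x = ε * gronwallBound 0 K 1 x := by
  unfold gronwallBound
  split_ifs <;> ring

/-- If the fields `A(·) u` commute, then the time one value of the solution of `γ' = A(γ) t`
depends on `t` with derivative `A(γ 1)`, up to a quadratic error. -/
lemma norm_radial_solution_sub_le {A : E → F →L[ℝ] E} {x₀ : E} {ρ : ℝ} {C : ℝ≥0}
    (hdiff : ∀ x ∈ closedBall x₀ ρ, DifferentiableAt ℝ A x)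
    (hbound : ∀ x ∈ closedBall x₀ ρ, ‖A x‖ ≤ C)
    (hlip : LipschitzOnWith C A (closedBall x₀ ρ))
    (hbound' : ∀ x ∈ closedBall x₀ ρ, ‖fderiv ℝ A x‖ ≤ C)
    (hlip' : LipschitzOnWith C (fderiv ℝ A) (closedBall x₀ ρ))
    (hcomm : ∀ x ∈ closedBall x₀ ρ, ∀ u v, fderiv ℝ A x (A x u) v = fderiv ℝ A x (A x v) u)
    {t h : F} {γ γ' : ℝ → E} (hγ0 : γ 0 = x₀) (hγ0' : γ' 0 = x₀)
    (hγρ : ∀ r, γ r ∈ closedBall x₀ (ρ / 2)) (hγρ' : ∀ r, γ' r ∈ closedBall x₀ ρ)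
    (hγ : ∀ r ∈ Icc (0 : ℝ) 1, HasDerivWithinAt γ (A (γ r) t) (Icc 0 1) r)
    (hγ' : ∀ r ∈ Icc (0 : ℝ) 1, HasDerivWithinAt γ' (A (γ' r) (t + h)) (Icc 0 1) r)
    (hh : C * ‖h‖ ≤ ρ / 2) (hth : ‖t + h‖ ≤ 1) :
    ‖γ' 1 - γ 1 - A (γ 1) h‖ ≤ (C * C + C * C * C) * gronwallBound 0 C 1 1 * ‖h‖ ^ 2 := by
  have hγρ1 : ∀ r, γ r ∈ closedBall x₀ ρ := fun r =>
    closedBall_subset_closedBall (by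
      have := dist_nonneg.trans (hγρ 0 : dist _ _ ≤ _); linarith) (hγρ r)
  have hAh : ∀ r ∈ Icc (0 : ℝ) 1, ‖r • A (γ r) h‖ ≤ C * ‖h‖ := fun r hr => by
    rw [norm_smul, Real.norm_of_nonneg hr.1]
    calc r * ‖A (γ r) h‖ ≤ 1 * (‖A (γ r)‖ * ‖h‖) := by
          gcongr; exacts [hr.2, (A (γ r)).le_opNorm h]
      _ ≤ 1 * (C * ‖h‖) := by gcongr; exact hbound _ (hγρ1 r)
      _ = _ := one_mul _
  have hηρ : ∀ r ∈ Icc (0 : ℝ) 1, γ r + r • A (γ r) h ∈ closedBall x₀ ρ := fun r hr => by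
    have h1 := hγρ r
    rw [mem_closedBall, dist_eq_norm] at h1 ⊢
    calc ‖γ r + r • A (γ r) h - x₀‖ = ‖(γ r - x₀) + r • A (γ r) h‖ := by congr 1; abel
      _ ≤ ‖γ r - x₀‖ + ‖r • A (γ r) h‖ := norm_add_le _ _
      _ ≤ ρ / 2 + ρ / 2 := add_le_add h1 ((hAh r hr).trans hh)
      _ = ρ := by ring
  -- The comparison curve is `η(r) = γ(r) + r A(γ r)h`, the first-order guess for the solution with
  -- parameter `t + h`. At `r = 1` it is `γ(1) + A(γ 1)h`.
  have hη : ∀ r ∈ Icc (0 : ℝ) 1, HasDerivWithinAt (fun r => γ r + r • A (γ r) h)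
      (A (γ r) t + (r • fderiv ℝ A (γ r) (A (γ r) t) h + (1 : ℝ) • A (γ r) h)) (Icc 0 1) r := by
    intro r hr
    refine (hγ r hr).add ((hasDerivWithinAt_id r _).smul ?_)
    have h1 := (hdiff _ (hγρ1 r)).hasFDerivAt.comp_hasDerivWithinAt r (hγ r hr)
    exact (ContinuousLinearMap.apply ℝ E h).hasFDerivAt.comp_hasDerivWithinAt r h1
  have hmem : ∀ r ∈ Ico (0 : ℝ) 1, Icc (0 : ℝ) 1 ∈ 𝓝[Ici r] r := fun r hr =>
    Filter.mem_of_superset (Icc_mem_nhdsGE hr.2) (Icc_subset_Icc hr.1 le_rfl)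
  have hIco : ∀ r ∈ Ico (0 : ℝ) 1, r ∈ Icc (0 : ℝ) 1 := fun r hr => Ico_subset_Icc_self hr
  -- Grönwall: `γ'` solves the equation for `t + h` exactly, `η` solves it up to `O(‖h‖²)`, and both
  -- start at `x₀`. The Lipschitz constant is `C` because `‖t + h‖ ≤ 1`.
  have key := dist_le_of_approx_trajectories_ODE_of_mem (a := 0) (b := 1) (δ := 0) (εf := 0)
    (εg := (C * C + C * C * C) * ‖h‖ ^ 2) (K := C) (s := fun _ => closedBall x₀ ρ)
    (v := fun _ x => A x (t + h)) (f := γ') (g := fun r => γ r + r • A (γ r) h)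
    (f' := fun r => A (γ' r) (t + h))
    (g' := fun r => A (γ r) t + (r • fderiv ℝ A (γ r) (A (γ r) t) h + (1 : ℝ) • A (γ r) h))
    (fun r _ => LipschitzOnWith.of_dist_le_mul fun x hx y hy => by
      have h1 := hlip.dist_le_mul x hx y hy
      rw [dist_eq_norm] at h1 ⊢
      calc ‖A x (t + h) - A y (t + h)‖ = ‖(A x - A y) (t + h)‖ := rfl
        _ ≤ ‖A x - A y‖ * ‖t + h‖ := (A x - A y).le_opNorm _
        _ ≤ (C * dist x y) * 1 := by gcongr
        _ = _ := mul_one _)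
    (fun r hr => (hγ' r hr).continuousWithinAt)
    (fun r hr => (hγ' r (hIco r hr)).mono_of_mem_nhdsWithin (hmem r hr))
    (fun r _ => (dist_self _).le) (fun r _ => hγρ' r)
    (fun r hr => (hη r hr).continuousWithinAt)
    (fun r hr => (hη r (hIco r hr)).mono_of_mem_nhdsWithin (hmem r hr))
    (fun r hr => ?_) (fun r hr => hηρ r (hIco r hr)) (by simp [hγ0, hγ0']) 1 (by simp)
  · rw [zero_add, sub_zero, gronwallBound_zero_left, dist_eq_norm] at key
    calc ‖γ' 1 - γ 1 - A (γ 1) h‖ = ‖γ' 1 - (γ 1 + (1 : ℝ) • A (γ 1) h)‖ := by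
          rw [one_smul, sub_sub]
      _ ≤ _ := key
      _ = _ := by ring
  · have hr' := hIco r hr
    set x := γ r with hx
    set w := r • A x h with hw
    have hxρ := hγρ1 r
    rw [← hx] at hxρ
    have hwn : ‖w‖ ≤ C * ‖h‖ := hAh r hr'
    have hy : x + w ∈ closedBall x₀ ρ := hηρ r hr'
    -- the Taylor expansion of `A` at `x`
    have hT : ‖A (x + w) - A x - fderiv ℝ A x w‖ ≤ C * ‖w‖ * ‖w‖ := by
      have hseg : segment ℝ x (x + w) ⊆ closedBall x₀ ρ :=
        (convex_closedBall x₀ ρ).segment_subset hxρ hy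
      have h1 := (convex_segment x (x + w)).norm_image_sub_le_of_norm_fderiv_le'
        (𝕜 := ℝ) (f := A) (φ := fderiv ℝ A x) (C := C * ‖w‖)
        (fun z hz => hdiff z (hseg hz)) (fun z hz => ?_)
        (left_mem_segment ℝ x (x + w)) (right_mem_segment ℝ x (x + w))
      · simpa using h1
      · have h2 := hlip'.dist_le_mul z (hseg hz) x hxρ
        rw [dist_eq_norm] at h2
        refine h2.trans ?_
        gcongr
        have h3 := norm_sub_le_of_mem_segment hz
        rw [dist_eq_norm]
        simpa using h3
    -- Here commutativity enters: with `w = r A(x)h` it turns `r DA(x)(A(x)t)h` into `DA(x)(w)t`,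
    -- which cancels the first-order term of `A(x + w)t`. What remains is the Taylor remainder and
    -- `DA(x)(w)h`, both quadratic in `h`.
    have hsplit : A x t + (r • fderiv ℝ A x (A x t) h + (1 : ℝ) • A x h) - A (x + w) (t + h) =
        -((A (x + w) - A x - fderiv ℝ A x w) (t + h)) - fderiv ℝ A x w h := by
      have h1 : fderiv ℝ A x w t = r • fderiv ℝ A x (A x t) h := by
        rw [hw, map_smul, smul_apply, hcomm x hxρ h t]
      simp only [sub_apply, map_add, one_smul]
      rw [h1]
      abel
    rw [dist_eq_norm]
    change ‖A x t + (r • fderiv ℝ A x (A x t) h + (1 : ℝ) • A x h) - A (x + w) (t + h)‖ ≤ _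
    rw [hsplit]
    have hC : (0 : ℝ) ≤ C := C.2
    calc _ ≤ ‖-((A (x + w) - A x - fderiv ℝ A x w) (t + h))‖ + ‖fderiv ℝ A x w h‖ :=
          norm_sub_le _ _
      _ ≤ ‖A (x + w) - A x - fderiv ℝ A x w‖ * ‖t + h‖ + ‖fderiv ℝ A x‖ * ‖w‖ * ‖h‖ := by
          rw [norm_neg]
          exact add_le_add (ContinuousLinearMap.le_opNorm _ _) (ContinuousLinearMap.le_opNorm₂ _ _ _)
      _ ≤ (C * (C * ‖h‖) * (C * ‖h‖)) * 1 + C * (C * ‖h‖) * ‖h‖ := by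
          gcongr
          · exact hT.trans (by gcongr)
          · exact hbound' x hxρ
      _ = _ := by ring

/-- If the fields `A(·) u` commute near `x₀`, then the total differential equation `Dψ = A ∘ ψ` has
a solution near `0` with `ψ 0 = x₀`. -/
theorem exists_solution_total_differential_equation [CompleteSpace E] {A : E → F →L[ℝ] E} {x₀ : E}
    {V : Set E} (hV : IsOpen V) (hx₀ : x₀ ∈ V) (hA : ContDiffOn ℝ ∞ A V)
    (hcomm : ∀ x ∈ V, ∀ u v, fderiv ℝ A x (A x u) v = fderiv ℝ A x (A x v) u) :
    ∃ δ > 0, ∃ ψ : F → E, ψ 0 = x₀ ∧ (∀ t ∈ ball 0 δ, ψ t ∈ V) ∧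
      (∀ t ∈ ball 0 δ, HasFDerivAt ψ (A (ψ t)) t) ∧ ContDiffOn ℝ ∞ ψ (ball 0 δ) := by
  have hVn : V ∈ 𝓝 x₀ := hV.mem_nhds hx₀
  have hA2 : ContDiffAt ℝ 2 A x₀ := (hA.contDiffAt hVn).of_le
    (WithTop.coe_le_coe.2 (le_top : (2 : ℕ∞) ≤ ⊤))
  have hA1 : ContDiffAt ℝ 1 (fderiv ℝ A) x₀ := hA2.fderiv_right (by norm_num)
  obtain ⟨K₁, s₁, hs₁, hK₁⟩ := (hA2.of_le (by norm_num)).exists_lipschitzOnWith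
  obtain ⟨K₂, s₂, hs₂, hK₂⟩ := hA1.exists_lipschitzOnWith
  have hb₁ : ∀ᶠ x in 𝓝 x₀, ‖A x‖ < ‖A x₀‖ + 1 :=
    hA2.continuousAt.norm.eventually_lt continuousAt_const (lt_add_one _)
  have hb₂ : ∀ᶠ x in 𝓝 x₀, ‖fderiv ℝ A x‖ < ‖fderiv ℝ A x₀‖ + 1 :=
    (hA1.continuousAt.eventually (Metric.ball_mem_nhds _ one_pos)).mono fun x hx => by
      have h1 : ‖fderiv ℝ A x - fderiv ℝ A x₀‖ < 1 := mem_ball_iff_norm.1 hx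
      have h2 : ‖fderiv ℝ A x‖ - ‖fderiv ℝ A x₀‖ ≤ ‖fderiv ℝ A x - fderiv ℝ A x₀‖ := norm_sub_norm_le (fderiv ℝ A x) (fderiv ℝ A x₀)
      linarith
  obtain ⟨ρ, hρ, hsub⟩ := nhds_basis_closedBall.mem_iff.1
    (Filter.inter_mem (Filter.inter_mem hVn (Filter.inter_mem hs₁ hs₂)) (hb₁.and hb₂))
  -- One constant dominates the Lipschitz constants and the bounds of both `A` and `DA`; the added
  -- ones make it positive, so that it can be divided by.
  set C : ℝ≥0 := K₁ + K₂ + (‖A x₀‖₊ + 1) + (‖fderiv ℝ A x₀‖₊ + 1) with hC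
  have hCr : (C : ℝ) = K₁ + K₂ + (‖A x₀‖ + 1) + (‖fderiv ℝ A x₀‖ + 1) := by
    rw [hC]; push_cast; rfl
  have hK₁0 : (0 : ℝ) ≤ K₁ := K₁.2
  have hK₂0 : (0 : ℝ) ≤ K₂ := K₂.2
  have hn₁ := norm_nonneg (A x₀)
  have hn₂ := norm_nonneg (fderiv ℝ A x₀)
  have hC0 : (0 : ℝ) < C := by rw [hCr]; linarith
  have hdiff : ∀ x ∈ closedBall x₀ ρ, DifferentiableAt ℝ A x := fun x hx =>
    (hA.contDiffAt (hV.mem_nhds (hsub hx).1.1)).differentiableAt (by simp)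
  have hbound : ∀ x ∈ closedBall x₀ ρ, ‖A x‖ ≤ C := fun x hx => by
    have := (hsub hx).2.1; rw [hCr]; linarith
  have hbound' : ∀ x ∈ closedBall x₀ ρ, ‖fderiv ℝ A x‖ ≤ C := fun x hx => by
    have := (hsub hx).2.2; rw [hCr]; linarith
  have hlip : LipschitzOnWith C A (closedBall x₀ ρ) :=
    (hK₁.mono fun x hx => (hsub hx).1.2.1).weaken (by
      rw [← NNReal.coe_le_coe, hCr]; linarith)
  have hlip' : LipschitzOnWith C (fderiv ℝ A) (closedBall x₀ ρ) :=
    (hK₂.mono fun x hx => (hsub hx).1.2.2).weaken (by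
      rw [← NNReal.coe_le_coe, hCr]; linarith)
  -- The bound `1` is needed for the Grönwall estimate. The bound `ρ / (2C)` keeps solutions in the
  -- half ball, leaving the other half for the increment `r A(γ r)h`.
  set δ : ℝ := min 1 (ρ / (2 * C)) with hδ
  have hδ0 : 0 < δ := lt_min one_pos (by positivity)
  have hδρ : ∀ t : F, ‖t‖ < δ → C * ‖t‖ ≤ ρ / 2 := fun t ht => by
    have h1 := ht.le.trans (min_le_right _ _)
    rw [le_div_iff₀ (by positivity)] at h1
    linarith
  have hex : ∀ t : F, ∃ γ : ℝ → E, ‖t‖ < δ → γ 0 = x₀ ∧ (∀ r, γ r ∈ closedBall x₀ (C * ‖t‖)) ∧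
      ∀ r ∈ Icc (0 : ℝ) 1, HasDerivWithinAt γ (A (γ r) t) (Icc 0 1) r := fun t => by
    by_cases ht : ‖t‖ < δ
    · obtain ⟨γ, hγ⟩ := exists_radial_solution hbound hlip ((hδρ t ht).trans (by linarith))
      exact ⟨γ, fun _ => hγ⟩
    -- A junk value, so that `γ` can be chosen for all `t` at once.
    · exact ⟨0, fun h => absurd h ht⟩
  choose γ hγ using hex
  have hγρ : ∀ t : F, ‖t‖ < δ → ∀ r, γ t r ∈ closedBall x₀ (ρ / 2) := fun t ht r =>
    closedBall_subset_closedBall (hδρ t ht) ((hγ t ht).2.1 r)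
  have hhalf : closedBall x₀ (ρ / 2) ⊆ closedBall x₀ ρ :=
    closedBall_subset_closedBall (by linarith)
  have hψV : ∀ t ∈ ball (0 : F) δ, γ t 1 ∈ V := fun t ht =>
    (hsub (hhalf (hγρ t (mem_ball_zero_iff.1 ht) 1))).1.1
  have hder : ∀ t ∈ ball (0 : F) δ, HasFDerivAt (fun t => γ t 1) (A (γ t 1)) t := by
    intro t ht
    have ht' := mem_ball_zero_iff.1 ht
    -- A quadratic error bound is a derivative: the estimate applies with `h = s - t`.
    have hO : (fun s => γ s 1 - γ t 1 - A (γ t 1) (s - t)) =O[𝓝 t] fun s => ‖s - t‖ ^ 2 := by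
      refine Asymptotics.IsBigO.of_bound
        ((C * C + C * C * C) * gronwallBound 0 C 1 1) ?_
      have hnear : ∀ᶠ s in 𝓝 t, ‖s - t‖ < δ := by
        have : Filter.Tendsto (fun s : F => ‖s - t‖) (𝓝 t) (𝓝 ‖t - t‖) :=
          ((continuous_id.sub continuous_const).norm).continuousAt
        exact this.eventually_lt_const (by simpa using hδ0)
      filter_upwards [isOpen_ball.mem_nhds ht, hnear] with s hs hst
      have hs' := mem_ball_zero_iff.1 hs
      have hts : t + (s - t) = s := add_sub_cancel t s
      rw [Real.norm_of_nonneg (by positivity : (0 : ℝ) ≤ ‖s - t‖ ^ 2)]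
      refine norm_radial_solution_sub_le hdiff hbound hlip hbound' hlip'
        (fun x hx => hcomm x (hsub hx).1.1) (hγ t ht').1 (hγ s hs').1 (hγρ t ht')
        (fun r => hhalf (hγρ s hs' r)) (hγ t ht').2.2 ?_ (hδρ _ hst) ?_
      · rw [hts]; exact (hγ s hs').2.2
      · rw [hts]; exact hs'.le.trans (min_le_left _ _)
    have h1 := hO.hasFDerivAt (𝕜 := ℝ) one_lt_two
    have h2 := (((A (γ t 1)).hasFDerivAt (x := t)).sub_const (A (γ t 1) t)).const_add (γ t 1)
    have h3 := h1.add h2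
    rw [zero_add] at h3
    refine h3.congr_of_eventuallyEq (Filter.Eventually.of_forall fun s => ?_)
    simp only [Pi.add_apply, map_sub]
    abel
  refine ⟨δ, hδ0, fun t => γ t 1, ?_, hψV, hder, ?_⟩
  · have h := (hγ 0 (by simpa using hδ0)).2.1 1
    simpa using h
  -- Bootstrapping: since `Dψ = A ∘ ψ`, a `C^n` solution has a `C^n` derivative.
  · rw [contDiffOn_infty]
    intro n
    induction n with
    | zero =>
      exact contDiffOn_zero.2 fun t ht => (hder t ht).continuousAt.continuousWithinAt
    | succ n ih =>
      rw [Nat.cast_succ, contDiffOn_succ_iff_fderiv_of_isOpen isOpen_ball]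
      refine ⟨fun t ht => (hder t ht).differentiableAt.differentiableWithinAt, by simp, ?_⟩
      refine (((hA.of_le (by exact_mod_cast le_top)).comp ih hψV).congr
        fun t ht => (hder t ht).fderiv)

end TotalDifferentialEquation

/-! ### Lie brackets of related vector fields -/

section Related

open VectorField

variable {E : Type*} [NormedAddCommGroup E] [NormedSpace ℝ E]
  {E' : Type*} [NormedAddCommGroup E'] [NormedSpace ℝ E']
  {M : Type*} [TopologicalSpace M] [ChartedSpace E M] [IsManifold 𝓘(ℝ, E) ∞ M]
  {M' : Type*} [TopologicalSpace M'] [ChartedSpace E' M'] [IsManifold 𝓘(ℝ, E') ∞ M']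

/-- Lie brackets of `f`-related vector fields are `f`-related, in vector spaces. -/
lemma fderiv_lieBracket_of_related {f : E → E'} {x : E} (hf : ContDiffAt ℝ 2 f x)
    {V W : E → E} {V' W' : E' → E'} (hV : DifferentiableAt ℝ V x) (hW : DifferentiableAt ℝ W x)
    (hV' : DifferentiableAt ℝ V' (f x)) (hW' : DifferentiableAt ℝ W' (f x))
    (hVV' : ∀ᶠ y in 𝓝 x, fderiv ℝ f y (V y) = V' (f y))
    (hWW' : ∀ᶠ y in 𝓝 x, fderiv ℝ f y (W y) = W' (f y)) :
    fderiv ℝ f x (lieBracket ℝ V W x) = lieBracket ℝ V' W' (f x) := by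
  have hf1 : DifferentiableAt ℝ f x := hf.differentiableAt (by norm_num)
  have hf2 : DifferentiableAt ℝ (fderiv ℝ f) x :=
    (hf.fderiv_right (m := 1) (by norm_num)).differentiableAt (by norm_num)
  -- Differentiate the relation `Df(Y) = Y' ∘ f` at `x` in the direction `v`.
  have key : ∀ {Y : E → E} {Y' : E' → E'}, DifferentiableAt ℝ Y x → DifferentiableAt ℝ Y' (f x) →
      (∀ᶠ y in 𝓝 x, fderiv ℝ f y (Y y) = Y' (f y)) → ∀ v : E,
      fderiv ℝ Y' (f x) (fderiv ℝ f x v) =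
        fderiv ℝ f x (fderiv ℝ Y x v) + fderiv ℝ (fderiv ℝ f) x v (Y x) := by
    intro Y Y' hY hY' h v
    have h1 := hf2.hasFDerivAt.clm_apply hY.hasFDerivAt
    have h2 := hY'.hasFDerivAt.comp x hf1.hasFDerivAt
    have h3 := (h1.congr_of_eventuallyEq
      (f₁ := Y' ∘ f) (h.mono fun y hy => hy.symm)).unique h2
    exact (congrArg (fun L : E →L[ℝ] E' => L v) h3).symm
  rw [lieBracket_eq, lieBracket_eq]
  simp only
  -- In the difference of the two instances of `key`, the second derivatives of `f` cancel by
  -- symmetry.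
  rw [← hVV'.self_of_nhds, ← hWW'.self_of_nhds, key hW hW' hWW', key hV hV' hVV',
    (hf.isSymmSndFDerivAt (by simp)).eq (V x) (W x), map_sub]
  abel

lemma contMDiffAt_extChartAt_symm {x : M} {y : E} (hy : y ∈ (extChartAt 𝓘(ℝ, E) x).target) :
    ContMDiffAt 𝓘(ℝ, E) 𝓘(ℝ, E) ∞ (extChartAt 𝓘(ℝ, E) x).symm y :=
  (contMDiffOn_extChartAt_symm x).contMDiffAt ((isOpen_extChartAt_target x).mem_nhds hy)

lemma isInvertible_mfderiv_extChartAt_symm {x : M} {y : E}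
    (hy : y ∈ (extChartAt 𝓘(ℝ, E) x).target) :
    (mfderiv 𝓘(ℝ, E) 𝓘(ℝ, E) (extChartAt 𝓘(ℝ, E) x).symm y).IsInvertible := by
  have h := isInvertible_mfderivWithin_extChartAt_symm hy
  rwa [modelWithCornersSelf_coe, range_id, mfderivWithin_univ] at h

/-- The local representative of a vector field in the chart around `x`. -/
def chartRep (x : M) (V : (q : M) → TangentSpace 𝓘(ℝ, E) q) (y : E) : E :=
  mpullback 𝓘(ℝ, E) 𝓘(ℝ, E) (extChartAt 𝓘(ℝ, E) x).symm V y

lemma mfderiv_chartRep (V : (q : M) → TangentSpace 𝓘(ℝ, E) q) {x : M} {y : E}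
    (hy : y ∈ (extChartAt 𝓘(ℝ, E) x).target) :
    (mfderiv 𝓘(ℝ, E) 𝓘(ℝ, E) (extChartAt 𝓘(ℝ, E) x).symm y : E →L[ℝ] E)
        (chartRep (E := E) x V y) =
      V ((extChartAt 𝓘(ℝ, E) x).symm y) :=
  ((isInvertible_mfderiv_extChartAt_symm hy).inverse_apply_eq.1 rfl).symm

/-- The uniqueness counterpart of `mfderiv_chartRep`, from invertibility of the differential of the
inverse chart. It transfers relatedness of fields on manifolds to their representatives. -/
lemma chartRep_eq_of_mfderiv_eq (V : (q : M) → TangentSpace 𝓘(ℝ, E) q) {x : M} {y : E}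
    (hy : y ∈ (extChartAt 𝓘(ℝ, E) x).target) {v : E}
    (h : mfderiv 𝓘(ℝ, E) 𝓘(ℝ, E) (extChartAt 𝓘(ℝ, E) x).symm y v =
      V ((extChartAt 𝓘(ℝ, E) x).symm y)) : chartRep x V y = v :=
  (isInvertible_mfderiv_extChartAt_symm hy).inverse_apply_eq.2 h.symm

lemma contDiffAt_chartRep [CompleteSpace E] {V : (q : M) → TangentSpace 𝓘(ℝ, E) q} {x : M} {y : E}
    (hy : y ∈ (extChartAt 𝓘(ℝ, E) x).target)
    (hV : ContMDiffAt 𝓘(ℝ, E) 𝓘(ℝ, E).tangent ∞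
      (fun q => (⟨q, V q⟩ : TangentBundle 𝓘(ℝ, E) M)) ((extChartAt 𝓘(ℝ, E) x).symm y)) :
    ContDiffAt ℝ ∞ (chartRep x V) y :=
  contMDiffAt_vectorSpace_iff_contDiffAt.1 (hV.mpullback_vectorField_preimage
    (contMDiffAt_extChartAt_symm hy) (isInvertible_mfderiv_extChartAt_symm hy) (by simp))

/-- The Lie bracket in terms of local representatives, at the centre of the chart. -/
lemma mlieBracket_eq_mfderiv_lieBracket (V W : (q : M) → TangentSpace 𝓘(ℝ, E) q) (x : M) :
    mlieBracket 𝓘(ℝ, E) V W x =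
      (mfderiv 𝓘(ℝ, E) 𝓘(ℝ, E) (extChartAt 𝓘(ℝ, E) x).symm (extChartAt 𝓘(ℝ, E) x x) : E →L[ℝ] E)
        (lieBracket (E := E) ℝ (chartRep x V) (chartRep x W) (extChartAt 𝓘(ℝ, E) x x)) := by
  rw [← mlieBracketWithin_univ, mlieBracketWithin_apply]
  -- The bracket on a manifold is defined through the inverse of the differential of the chart; this
  -- identity lets the differential of the inverse chart replace it.
  have h' := mfderiv_extChartAt_comp_mfderivWithin_extChartAt_symm (I := 𝓘(ℝ, E))
    (mem_extChartAt_target (I := 𝓘(ℝ, E)) x)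
  simp only [modelWithCornersSelf_coe, range_id, mfderivWithin_univ, preimage_univ, inter_self,
    mpullbackWithin_univ] at h' ⊢
  refine (isInvertible_mfderiv_extChartAt (mem_extChartAt_source x)).inverse_apply_eq.2 ?_
  rw [extChartAt_to_inv] at h'
  have h'' := congrArg (fun L : E →L[ℝ] E =>
    L (lieBracket (E := E) ℝ (chartRep x V) (chartRep x W) (extChartAt 𝓘(ℝ, E) x x))) h'
  refine Eq.trans ?_ h''.symm
  exact congrFun (lieBracketWithin_univ (V := chartRep (E := E) x V) (W := chartRep (E := E) x W)) _

/-- Lie brackets of `f`-related vector fields are `f`-related. -/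
theorem mfderiv_mlieBracket_of_related [CompleteSpace E] [CompleteSpace E'] {f : M → M'} {x : M}
    (hf : ContMDiff 𝓘(ℝ, E) 𝓘(ℝ, E') ∞ f)
    {V W : (q : M) → TangentSpace 𝓘(ℝ, E) q} {V' W' : (q : M') → TangentSpace 𝓘(ℝ, E') q}
    (hV : ContMDiffAt 𝓘(ℝ, E) 𝓘(ℝ, E).tangent ∞ (fun q => (⟨q, V q⟩ : TangentBundle 𝓘(ℝ, E) M)) x)
    (hW : ContMDiffAt 𝓘(ℝ, E) 𝓘(ℝ, E).tangent ∞ (fun q => (⟨q, W q⟩ : TangentBundle 𝓘(ℝ, E) M)) x)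
    (hV' : ContMDiffAt 𝓘(ℝ, E') 𝓘(ℝ, E').tangent ∞
      (fun q => (⟨q, V' q⟩ : TangentBundle 𝓘(ℝ, E') M')) (f x))
    (hW' : ContMDiffAt 𝓘(ℝ, E') 𝓘(ℝ, E').tangent ∞
      (fun q => (⟨q, W' q⟩ : TangentBundle 𝓘(ℝ, E') M')) (f x))
    (hVV' : ∀ q, mfderiv 𝓘(ℝ, E) 𝓘(ℝ, E') f q (V q) = V' (f q))
    (hWW' : ∀ q, mfderiv 𝓘(ℝ, E) 𝓘(ℝ, E') f q (W q) = W' (f q)) :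
    mfderiv 𝓘(ℝ, E) 𝓘(ℝ, E') f x (mlieBracket 𝓘(ℝ, E) V W x) =
      mlieBracket 𝓘(ℝ, E') V' W' (f x) := by
  set φ := extChartAt 𝓘(ℝ, E) x with hφ
  set φ' := extChartAt 𝓘(ℝ, E') (f x) with hφ'
  set F : E → E' := fun y => φ' (f (φ.symm y)) with hF
  have hx : φ x ∈ φ.target := mem_extChartAt_target x
  have hφx : φ.symm (φ x) = x := extChartAt_to_inv x
  have hFx : F (φ x) = φ' (f x) := by rw [hF]; simp only [hφx]
  have hgood : ∀ᶠ y in 𝓝 (φ x), y ∈ φ.target ∧ f (φ.symm y) ∈ φ'.source := by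
    refine Filter.Eventually.and ((isOpen_extChartAt_target x).mem_nhds hx) ?_
    refine (hf.continuous.continuousAt.comp (continuousAt_extChartAt_symm x)).preimage_mem_nhds ?_
    simp only [Function.comp, ← hφ, hφx]
    exact extChartAt_source_mem_nhds (f x)
  have hFsmooth : ∀ y, y ∈ φ.target → f (φ.symm y) ∈ φ'.source → ContDiffAt ℝ ∞ F y := by
    intro y hy hy'
    have h1 := (hf (φ.symm y)).comp y (contMDiffAt_extChartAt_symm hy)
    have h2 : ContMDiffAt 𝓘(ℝ, E') 𝓘(ℝ, E') ∞ φ' (f (φ.symm y)) :=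
      contMDiffAt_extChartAt' (by rwa [← extChartAt_source 𝓘(ℝ, E')])
    exact (h2.comp y h1).contDiffAt
  -- The chain rule for `f ∘ φ.symm = φ'.symm ∘ F`, which holds near `y`.
  have hchain : ∀ y, y ∈ φ.target → f (φ.symm y) ∈ φ'.source → ∀ v : E,
      (mfderiv 𝓘(ℝ, E) 𝓘(ℝ, E') f (φ.symm y) : E →L[ℝ] E')
        ((mfderiv 𝓘(ℝ, E) 𝓘(ℝ, E) φ.symm y : E →L[ℝ] E) v) =
      (mfderiv 𝓘(ℝ, E') 𝓘(ℝ, E') φ'.symm (F y) : E' →L[ℝ] E') (fderiv ℝ F y v) := by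
    intro y hy hy'
    have hFy : F y ∈ φ'.target := φ'.map_source hy'
    have h1 := ((hf.mdifferentiable (by simp)) (φ.symm y)).hasMFDerivAt.comp y
      ((contMDiffAt_extChartAt_symm hy).mdifferentiableAt (by simp)).hasMFDerivAt
    have h2 := ((contMDiffAt_extChartAt_symm hFy).mdifferentiableAt (by simp)).hasMFDerivAt.comp y
      ((hFsmooth y hy hy').differentiableAt (by simp)).hasFDerivAt.hasMFDerivAt
    have hev : f ∘ φ.symm =ᶠ[𝓝 y] φ'.symm ∘ F := by
      have : ∀ᶠ z in 𝓝 y, f (φ.symm z) ∈ φ'.source :=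
        (hf.continuous.continuousAt.comp
          (contMDiffAt_extChartAt_symm hy).continuousAt).preimage_mem_nhds
          ((isOpen_extChartAt_source (f x)).mem_nhds hy')
      exact this.mono fun z hz => (φ'.left_inv hz).symm
    have h3 := hasMFDerivAt_unique h1 (h2.congr_of_eventuallyEq hev)
    exact fun v => congrArg (fun L : E →L[ℝ] E' => L v) h3
  have hrel : ∀ {Y : (q : M) → TangentSpace 𝓘(ℝ, E) q} {Y' : (q : M') → TangentSpace 𝓘(ℝ, E') q},
      (∀ q, mfderiv 𝓘(ℝ, E) 𝓘(ℝ, E') f q (Y q) = Y' (f q)) →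
      ∀ᶠ y in 𝓝 (φ x), fderiv ℝ F y (chartRep x Y y) = chartRep (f x) Y' (F y) := by
    intro Y Y' h
    filter_upwards [hgood] with y ⟨hy, hy'⟩
    symm
    refine chartRep_eq_of_mfderiv_eq Y' (φ'.map_source hy') ((hchain y hy hy' _).symm.trans ?_)
    rw [mfderiv_chartRep Y hy]
    refine (h _).trans ?_
    change Y' (f (φ.symm y)) = Y' (φ'.symm (φ' (f (φ.symm y))))
    rw [φ'.left_inv hy']
  have hg := hgood.self_of_nhds
  have key := fderiv_lieBracket_of_related ((hFsmooth _ hg.1 hg.2).of_le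
    (WithTop.coe_le_coe.2 (le_top : (2 : ℕ∞) ≤ ⊤)))
    ((contDiffAt_chartRep hx (by rwa [hφx])).differentiableAt (by simp))
    ((contDiffAt_chartRep hx (by rwa [hφx])).differentiableAt (by simp))
    ((contDiffAt_chartRep (φ'.map_source hg.2) (by rwa [φ'.left_inv hg.2, hφx])).differentiableAt (by simp))
    ((contDiffAt_chartRep (φ'.map_source hg.2) (by rwa [φ'.left_inv hg.2, hφx])).differentiableAt (by simp))
    (hrel hVV') (hrel hWW')
  rw [mlieBracket_eq_mfderiv_lieBracket V' W', ← hφ', ← hFx, ← key]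
  refine Eq.trans ?_ (hchain _ hg.1 hg.2 _)
  rw [mlieBracket_eq_mfderiv_lieBracket V W]
  exact congrArg (fun z => (mfderiv 𝓘(ℝ, E) 𝓘(ℝ, E') f z : E →L[ℝ] E')
    ((mfderiv 𝓘(ℝ, E) 𝓘(ℝ, E) φ.symm (φ x) : E →L[ℝ] E)
      (lieBracket (E := E) ℝ (chartRep x V) (chartRep x W) (φ x)))) hφx.symm

end Related

/-! ### Integrability in terms of Lie brackets -/

section Integrability

open VectorField

lemma mlieBracket_vectorSpace_eq_lieBracket {E : Type*} [NormedAddCommGroup E] [NormedSpace ℝ E]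
    (V W : E → E) (x : E) : mlieBracket 𝓘(ℝ, E) V W x = lieBracket ℝ V W x :=
  (congrFun (mlieBracketWithin_eq_lieBracketWithin (V := V) (W := W) (s := univ)) x).trans
    (congrFun lieBracketWithin_univ x)

open TopologicalSpace in
-- The inclusion into `E` has identity differential and relates these fields to constant fields on
-- `E`, whose bracket is zero.
lemma mlieBracket_opens_const {E : Type*} [NormedAddCommGroup E] [NormedSpace ℝ E]
    [CompleteSpace E] {U : Opens E} (v w : E) (t : U) :
    mlieBracket 𝓘(ℝ, E) (fun _ : U => (v : E)) (fun _ => w) t = 0 := by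
  have hc : ∀ u : E, ContMDiff 𝓘(ℝ, E) 𝓘(ℝ, E).tangent ∞
      (fun t : E => (⟨t, u⟩ : TangentBundle 𝓘(ℝ, E) E)) := fun u =>
    contMDiff_vectorSpace_iff_contDiff.2 contDiff_const
  have hr : ∀ (u : E) (q : U), mfderiv 𝓘(ℝ, E) 𝓘(ℝ, E) (Subtype.val : U → E) q u = u := fun u q => by
    rw [(mfderiv_opens_val q).mfderiv]; rfl
  have h := mfderiv_mlieBracket_of_related (f := (Subtype.val : U → E)) (x := t)
    (V := fun _ => v) (W := fun _ => w) (V' := fun _ => v) (W' := fun _ => w)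
    contMDiff_subtype_val (contMDiff_opens_const v t) (contMDiff_opens_const w t)
    (hc v t) (hc w t) (hr v) (hr w)
  refine (hr _ t).symm.trans (h.trans ?_)
  have h0 : lieBracket ℝ (fun _ : E => v) (fun _ => w) (t : E) = 0 := by simp [lieBracket_eq]
  exact (mlieBracket_vectorSpace_eq_lieBracket (fun _ => v) (fun _ => w) (t : E)).trans h0

variable {k : ℕ} {E : Type*} [NormedAddCommGroup E] [NormedSpace ℝ E]
  {M : Type*} [TopologicalSpace M] [ChartedSpace E M] [IsManifold 𝓘(ℝ, E) ∞ M]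

/-- The components of a `k`-vector field commute along its integral sections. -/
lemma KVectorField.IsIntegralSection.mlieBracket_eq_zero [CompleteSpace E] {X : KVectorField k E M}
    {U : TopologicalSpace.Opens (EuclideanSpace ℝ (Fin k))}
    {φ : C^∞⟮𝓘(ℝ, EuclideanSpace ℝ (Fin k)), U; 𝓘(ℝ, E), M⟯} (hφ : X.IsIntegralSection φ)
    (t : U) (a b : Fin k) : mlieBracket 𝓘(ℝ, E) (X.comp a) (X.comp b) (φ t) = 0 := by
  have h := mfderiv_mlieBracket_of_related (x := t) (V := fun _ => dt a) (W := fun _ => dt b)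
    φ.contMDiff (contMDiff_opens_const _ t) (contMDiff_opens_const _ t) (X.smooth a _)
    (X.smooth b _) (fun q => hφ.2 q a) (fun q => hφ.2 q b)
  rw [← h, mlieBracket_opens_const]
  exact map_zero _

/-- A `k`-vector field with commuting components is integrable. -/
lemma KVectorField.isIntegrable_of_mlieBracket_eq_zero [CompleteSpace E] {X : KVectorField k E M}
    (hX : ∀ (a b : Fin k) (p : M), mlieBracket 𝓘(ℝ, E) (X.comp a) (X.comp b) p = 0) :
    X.IsIntegrable := by
  have hM : IsManifold 𝓘(ℝ, E) (minSmoothness ℝ 2) M := by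
    rw [minSmoothness_of_isRCLikeNormedField]
    infer_instance
  have hE : IsManifold 𝓘(ℝ, E) (minSmoothness ℝ 2) E := by
    rw [minSmoothness_of_isRCLikeNormedField]
    infer_instance
  intro p
  set φ := extChartAt 𝓘(ℝ, E) p with hφ
  set Y : Fin k → E → E := fun a => chartRep p (X.comp a) with hY
  have hYs : ∀ a, ∀ y ∈ φ.target, ContDiffAt ℝ ∞ (Y a) y := fun a y hy =>
    contDiffAt_chartRep hy (X.smooth a _)
  have hYb : ∀ a b, ∀ y ∈ φ.target, fderiv ℝ (Y b) y (Y a y) = fderiv ℝ (Y a) y (Y b y) := by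
    intro a b y hy
    -- Pullback by the inverse chart commutes with brackets, so the local representatives commute on
    -- the whole chart target.
    have h1 := mpullback_mlieBracket (n := ∞) (V := X.comp a) (W := X.comp b)
      ((X.smooth a).mdifferentiable (by simp) _) ((X.smooth b).mdifferentiable (by simp) _)
      (contMDiffAt_extChartAt_symm hy)
      (by simpa using WithTop.coe_le_coe.2 (le_top : (2 : ℕ∞) ≤ ⊤))
    have h2 : mpullback 𝓘(ℝ, E) 𝓘(ℝ, E) φ.symm
        (mlieBracket 𝓘(ℝ, E) (X.comp a) (X.comp b)) y = 0 := by
      rw [mpullback_apply, hX]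
      exact map_zero _
    have h3 := (mlieBracket_vectorSpace_eq_lieBracket (Y a) (Y b) y).symm.trans (h1.symm.trans h2)
    exact sub_eq_zero.1 h3
  -- The map `A(y)v = ∑ v_a Y_a(y)` packs the `k` equations `∂ψ/∂tᵃ = Y_a(ψ)` into the single
  -- equation `Dψ = A(ψ)`.
  set A : E → EuclideanSpace ℝ (Fin k) →L[ℝ] E := fun y =>
    ∑ a, ContinuousLinearMap.smulRightL ℝ (EuclideanSpace ℝ (Fin k)) E
      (EuclideanSpace.proj a) (Y a y) with hA
  have hAapp : ∀ y v, A y v = ∑ a, v a • Y a y := fun y v => by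
    simp [hA]
  have hAs : ContDiffOn ℝ ∞ A φ.target := fun y hy =>
    (ContDiffAt.sum fun a _ => (ContinuousLinearMap.contDiff _).contDiffAt.comp y
      (hYs a y hy)).contDiffWithinAt
  have hAd : ∀ y ∈ φ.target, ∀ w v, fderiv ℝ A y w v = ∑ a, v a • fderiv ℝ (Y a) y w := by
    intro y hy w v
    have h : HasFDerivAt A (∑ a, (ContinuousLinearMap.smulRightL ℝ (EuclideanSpace ℝ (Fin k)) E
        (EuclideanSpace.proj a)).comp (fderiv ℝ (Y a) y)) y :=
      HasFDerivAt.fun_sum fun a _ => (ContinuousLinearMap.hasFDerivAt _).comp y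
        ((hYs a y hy).differentiableAt (by simp)).hasFDerivAt
    rw [h.fderiv]
    simp
  obtain ⟨δ, hδ, ψ, hψ0, hψV, hψd, hψs⟩ := exists_solution_total_differential_equation
    (isOpen_extChartAt_target p) (mem_extChartAt_target p) hAs (fun y hy u v => by
      -- Both sides expand into double sums over pairs `(a, b)`; after exchanging the order of
      -- summation they agree term by term by `hYb`.
      rw [hAd y hy, hAd y hy, hAapp, hAapp]
      simp only [map_sum, map_smul, Finset.smul_sum]
      rw [Finset.sum_comm]
      refine Finset.sum_congr rfl fun a _ => Finset.sum_congr rfl fun b _ => ?_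
      rw [smul_comm, hYb a b y hy])
  let U : TopologicalSpace.Opens (EuclideanSpace ℝ (Fin k)) := ⟨Metric.ball 0 δ, Metric.isOpen_ball⟩
  have hψU : ∀ t : U, ContMDiffAt 𝓘(ℝ, EuclideanSpace ℝ (Fin k)) 𝓘(ℝ, E) ∞
      (fun t : U => ψ t) t := fun t =>
    (hψs.contDiffAt (Metric.isOpen_ball.mem_nhds t.2)).contMDiffAt.comp t
      (contMDiff_subtype_val t)
  refine ⟨U, ⟨fun t => φ.symm (ψ t), fun t =>
    (contMDiffAt_extChartAt_symm (hψV t t.2)).comp t (hψU t)⟩, ⟨Metric.mem_ball_self hδ, ?_⟩, ?_⟩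
  · intro t a
    have h1 := ((contMDiffAt_extChartAt_symm (hψV t t.2)).mdifferentiableAt (by simp)).hasMFDerivAt
    have h2 : HasMFDerivAt 𝓘(ℝ, EuclideanSpace ℝ (Fin k)) 𝓘(ℝ, E) (fun t : U => ψ t) t
        ((A (ψ t)).comp (ContinuousLinearMap.id ℝ _)) :=
      HasMFDerivAt.comp t (hψd t t.2).hasMFDerivAt (mfderiv_opens_val t)
    have h3 := (HasMFDerivAt.comp t h1 h2).mfderiv
    refine (congrArg (fun L : EuclideanSpace ℝ (Fin k) →L[ℝ] E => L (dt a)) h3).trans ?_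
    have h4 : A (ψ t) (dt a) = Y a (ψ t) := by
      rw [hAapp]
      simp
    refine Eq.trans ?_ (mfderiv_chartRep (X.comp a) (hψV t t.2))
    exact congrArg (mfderiv 𝓘(ℝ, E) 𝓘(ℝ, E) φ.symm (ψ t) : E →L[ℝ] E) h4
  · intro t ht
    change φ.symm (ψ t) = p
    rw [ht, hψ0]
    exact extChartAt_to_inv p

/-- A `k`-vector field is integrable if and only if its components commute. -/
theorem KVectorField.isIntegrable_iff_mlieBracket_eq_zero [CompleteSpace E]
    {X : KVectorField k E M} : X.IsIntegrable ↔
      ∀ (a b : Fin k) (p : M), mlieBracket 𝓘(ℝ, E) (X.comp a) (X.comp b) p = 0 := by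
  refine ⟨fun h a b p => ?_, KVectorField.isIntegrable_of_mlieBracket_eq_zero⟩
  obtain ⟨U, φ, hφ, hp⟩ := h p
  rw [← hp ⟨0, hφ.1⟩ rfl]
  exact hφ.mlieBracket_eq_zero _ a b

end Integrability

/-! ### Lie brackets of combinations with function coefficients -/

section LieBracketSum

open VectorField

variable {E : Type*} [NormedAddCommGroup E] [NormedSpace ℝ E] [CompleteSpace E]
  {M : Type*} [TopologicalSpace M] [ChartedSpace E M] [IsManifold 𝓘(ℝ, E) ∞ M]

/-- If the brackets `[V, Z a]` at `x` and the vectors `Z a x` lie in a subspace, then so does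
`[V, ∑ f a • Z a] x`. -/
lemma mlieBracket_sum_smul_mem {ι : Type*} (s : Finset ι) {x : M}
    (S : Submodule ℝ (TangentSpace 𝓘(ℝ, E) x)) {V : (q : M) → TangentSpace 𝓘(ℝ, E) q}
    {Z : ι → (q : M) → TangentSpace 𝓘(ℝ, E) q} {f : ι → M → ℝ}
    (hZ : ∀ a, ContMDiffAt 𝓘(ℝ, E) 𝓘(ℝ, E).tangent ∞
      (fun q => (⟨q, Z a q⟩ : TangentBundle 𝓘(ℝ, E) M)) x)
    (hf : ∀ a, ContMDiffAt 𝓘(ℝ, E) 𝓘(ℝ, ℝ) ∞ (f a) x)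
    (hmem : ∀ a, Z a x ∈ S) (hbr : ∀ a, mlieBracket 𝓘(ℝ, E) V (Z a) x ∈ S) :
    mlieBracket 𝓘(ℝ, E) V (fun q => ∑ a ∈ s, f a q • Z a q) x ∈ S := by
  classical
  induction s using Finset.induction_on with
  | empty =>
    have h : (fun q => ∑ a ∈ (∅ : Finset ι), f a q • Z a q) =
        (0 : (q : M) → TangentSpace 𝓘(ℝ, E) q) := by
      funext q; simp
    rw [h, mlieBracket_zero_right]
    exact S.zero_mem
  | insert b s hb ih =>
    have hfZ : ∀ a, ContMDiffAt 𝓘(ℝ, E) 𝓘(ℝ, E).tangent ∞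
        (fun q => (⟨q, f a q • Z a q⟩ : TangentBundle 𝓘(ℝ, E) M)) x := fun a =>
      (hf a).smul_section (hZ a)
    have h : (fun q => ∑ a ∈ insert b s, f a q • Z a q) =
        (f b • Z b) + fun q => ∑ a ∈ s, f a q • Z a q := by
      funext q
      rw [Finset.sum_insert hb]
      rfl
    have hsum : ContMDiffAt 𝓘(ℝ, E) 𝓘(ℝ, E).tangent ∞
        (fun q => (⟨q, ∑ a ∈ s, f a q • Z a q⟩ : TangentBundle 𝓘(ℝ, E) M)) x :=
      ContMDiffAt.sum_section (t := fun a q => f a q • Z a q) fun a _ => hfZ a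
    -- The Leibniz rule `[V, fZ] = (Vf)Z + f[V, Z]`: both terms lie in `S`.
    rw [h, mlieBracket_add_right (W := f b • Z b) ((hfZ b).mdifferentiableAt (by simp))
      (hsum.mdifferentiableAt (by simp)), mlieBracket_smul_right
      ((hf b).mdifferentiableAt (by simp)) ((hZ b).mdifferentiableAt (by simp))]
    exact S.add_mem (S.add_mem (S.smul_mem _ (hmem b)) (S.smul_mem _ (hbr b))) ih

/-- Linear combinations, with functions as coefficients, of vector fields with vanishing Lie
brackets span, at every point, a subspace closed under Lie brackets. -/
lemma mlieBracket_sum_smul_sum_smul_mem {ι : Type*} [Fintype ι] {x : M}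
    (S : Submodule ℝ (TangentSpace 𝓘(ℝ, E) x))
    {Z : ι → (q : M) → TangentSpace 𝓘(ℝ, E) q} {f g : ι → M → ℝ}
    (hZ : ∀ a, ContMDiffAt 𝓘(ℝ, E) 𝓘(ℝ, E).tangent ∞
      (fun q => (⟨q, Z a q⟩ : TangentBundle 𝓘(ℝ, E) M)) x)
    (hf : ∀ a, ContMDiffAt 𝓘(ℝ, E) 𝓘(ℝ, ℝ) ∞ (f a) x)
    (hg : ∀ a, ContMDiffAt 𝓘(ℝ, E) 𝓘(ℝ, ℝ) ∞ (g a) x)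
    (hmem : ∀ a, Z a x ∈ S) (hbr : ∀ a b, mlieBracket 𝓘(ℝ, E) (Z a) (Z b) x = 0) :
    mlieBracket 𝓘(ℝ, E) (fun q => ∑ a, f a q • Z a q) (fun q => ∑ a, g a q • Z a q) x ∈ S := by
  refine mlieBracket_sum_smul_mem _ S hZ hg hmem fun b => ?_
  -- The second slot has been expanded; antisymmetry lets the same lemma expand the first.
  rw [mlieBracket_swap_apply]
  refine S.neg_mem (mlieBracket_sum_smul_mem _ S hZ hf hmem fun a => ?_)
  rw [hbr]
  exact S.zero_mem

end LieBracketSum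

/-! ### Flatness of the induced connection in terms of Lie brackets -/

section InducedConnectionFlat

open VectorField

variable {k : ℕ}
  {EG : Type*} [NormedAddCommGroup EG] [NormedSpace ℝ EG]
  {EP : Type*} [NormedAddCommGroup EP] [NormedSpace ℝ EP]
  {EB : Type*} [NormedAddCommGroup EB] [NormedSpace ℝ EB]
  {G : Type*} [TopologicalSpace G] [ChartedSpace EG G] [Group G] [LieGroup 𝓘(ℝ, EG) ∞ G]
  {P : Type*} [TopologicalSpace P] [ChartedSpace EP P] [IsManifold 𝓘(ℝ, EP) ∞ P]
  [MulAction G P] [ContMDiffSMul 𝓘(ℝ, EG) 𝓘(ℝ, EP) ∞ G P]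
  {B : Type*} [TopologicalSpace B] [ChartedSpace EB B] [IsManifold 𝓘(ℝ, EB) ∞ B]
  {ξ : PrincipalBundle EG EP EB G P B}
  {U : TopologicalSpace.Opens (EuclideanSpace ℝ (Fin k))}
  {φ : C^∞⟮𝓘(ℝ, EuclideanSpace ℝ (Fin k)), U; 𝓘(ℝ, EB), B⟯}
  {X : KVectorField k EP P}

namespace PrincipalBundle

namespace PullbackSpace

/-- The differential of the projection `φ^*P → U`. -/
def baseDeriv (s : ξ.PullbackSpace φ) :
    EuclideanSpace ℝ (Fin k) × EG →L[ℝ] EuclideanSpace ℝ (Fin k) :=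
  mfderiv 𝓘(ℝ, EuclideanSpace ℝ (Fin k) × EG) 𝓘(ℝ, EuclideanSpace ℝ (Fin k))
    (base : ξ.PullbackSpace φ → U) s

/-- The differential of the projection `φ^*P → P`. -/
def ptDeriv (s : ξ.PullbackSpace φ) : EuclideanSpace ℝ (Fin k) × EG →L[ℝ] EP :=
  mfderiv 𝓘(ℝ, EuclideanSpace ℝ (Fin k) × EG) 𝓘(ℝ, EP) (pt : ξ.PullbackSpace φ → P) s

/-- The inclusion of `φ^*P` in `U × P` is an immersion, so identities between tangent vectors can be
checked on the two components. -/
lemma eq_of_baseDeriv_eq_of_ptDeriv_eq (s : ξ.PullbackSpace φ)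
    {v w : EuclideanSpace ℝ (Fin k) × EG} (h₁ : baseDeriv s v = baseDeriv s w)
    (h₂ : ptDeriv s v = ptDeriv s w) : v = w := by
  refine sub_eq_zero.1 (mfderiv_incl_injective s ((mfderiv_incl_apply s (v - w)).trans ?_))
  exact Prod.ext ((map_sub (baseDeriv s) v w).trans (sub_eq_zero.2 h₁))
    ((map_sub (ptDeriv s) v w).trans (sub_eq_zero.2 h₂))

/-- The components of the projection to `ℝᵏ` of a smooth vector field on `φ^*P` are smooth. -/
lemma contMDiff_baseDeriv_apply
    {Y : (s : ξ.PullbackSpace φ) → TangentSpace 𝓘(ℝ, EuclideanSpace ℝ (Fin k) × EG) s}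
    (hY : ContMDiff 𝓘(ℝ, EuclideanSpace ℝ (Fin k) × EG)
      𝓘(ℝ, EuclideanSpace ℝ (Fin k) × EG).tangent ∞ (fun s => (⟨s, Y s⟩ :
        TangentBundle 𝓘(ℝ, EuclideanSpace ℝ (Fin k) × EG) (ξ.PullbackSpace φ)))) (a : Fin k) :
    ContMDiff 𝓘(ℝ, EuclideanSpace ℝ (Fin k) × EG) 𝓘(ℝ, ℝ) ∞
      (fun s : ξ.PullbackSpace φ => (baseDeriv s (Y s) : EuclideanSpace ℝ (Fin k)) a) := by
  have hb : ContMDiff 𝓘(ℝ, EuclideanSpace ℝ (Fin k) × EG) 𝓘(ℝ, EuclideanSpace ℝ (Fin k)) ∞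
      (fun s : ξ.PullbackSpace φ => (s.base : EuclideanSpace ℝ (Fin k))) :=
    contMDiff_subtype_val.comp contMDiff_base
  have h1 := (contMDiff_snd_tangentBundle_modelSpace (n := ∞) (EuclideanSpace ℝ (Fin k))
    𝓘(ℝ, EuclideanSpace ℝ (Fin k))).comp ((hb.contMDiff_tangentMap (m := ∞) (by simp)).comp hY)
  have h2 : ContMDiff 𝓘(ℝ, EuclideanSpace ℝ (Fin k) × EG) 𝓘(ℝ, EuclideanSpace ℝ (Fin k)) ∞
      (fun s : ξ.PullbackSpace φ => (baseDeriv s (Y s) : EuclideanSpace ℝ (Fin k))) := by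
    refine h1.congr fun s => ?_
    -- The inclusion of `U` in `ℝᵏ` has identity differential, so passing to `ℝᵏ`, where the tangent
    -- bundle is trivial, does not change the derivative.
    have h3 := (HasMFDerivAt.comp s (mfderiv_opens_val s.base)
      (mdifferentiableAt_base s).hasMFDerivAt).mfderiv
    exact (congrArg (fun L : EuclideanSpace ℝ (Fin k) × EG →L[ℝ] EuclideanSpace ℝ (Fin k) =>
      L (Y s)) h3).symm
  exact (EuclideanSpace.proj (𝕜 := ℝ) a).contMDiff.comp h2

end PullbackSpace

open PullbackSpace

lemma sum_pi_single_smul {E : Type*} [AddCommGroup E] [Module ℝ E] (a : Fin k) (x : Fin k → E) :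
    ∑ b, (Pi.single a 1 : Fin k → ℝ) b • x b = x a := by
  simp [Pi.single_apply]

lemma exists_liftedField (hX : X.IsInvariant G) (hφ : (ξ.reduced X hX).IsIntegralSection φ)
    (a : Fin k) (s : ξ.PullbackSpace φ) : ∃ v : EuclideanSpace ℝ (Fin k) × EG,
      baseDeriv s v = dt a ∧ ptDeriv s v = (X.comp a s.pt : EP) := by
  obtain ⟨W, Y, -, hs, -, hW⟩ := ξ.exists_horizontal_vectorField X φ hX hφ (Pi.single a 1) s
  obtain ⟨h₁, h₂⟩ := hW s hs
  exact ⟨Y s, h₁.trans (sum_pi_single_smul a _),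
    h₂.trans (sum_pi_single_smul (E := EP) a fun b => X.comp b s.pt)⟩

/-- The vector field `∂/∂tᵃ + X_a` on `φ^*P`. -/
def liftedField (hX : X.IsInvariant G) (hφ : (ξ.reduced X hX).IsIntegralSection φ)
    (a : Fin k) (s : ξ.PullbackSpace φ) :
    TangentSpace 𝓘(ℝ, EuclideanSpace ℝ (Fin k) × EG) s :=
  (exists_liftedField hX hφ a s).choose

lemma baseDeriv_liftedField (hX : X.IsInvariant G) (hφ : (ξ.reduced X hX).IsIntegralSection φ)
    (a : Fin k) (s : ξ.PullbackSpace φ) : baseDeriv s (liftedField hX hφ a s) = dt a :=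
  (exists_liftedField hX hφ a s).choose_spec.1

lemma ptDeriv_liftedField (hX : X.IsInvariant G) (hφ : (ξ.reduced X hX).IsIntegralSection φ)
    (a : Fin k) (s : ξ.PullbackSpace φ) :
    ptDeriv s (liftedField hX hφ a s) = (X.comp a s.pt : EP) :=
  (exists_liftedField hX hφ a s).choose_spec.2

/-- `liftedField` is chosen point by point, but its two components determine it, so near each point
it agrees with the smooth local field of `exists_horizontal_vectorField`. -/
lemma contMDiff_liftedField (hX : X.IsInvariant G) (hφ : (ξ.reduced X hX).IsIntegralSection φ)
    (a : Fin k) : ContMDiff 𝓘(ℝ, EuclideanSpace ℝ (Fin k) × EG)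
      𝓘(ℝ, EuclideanSpace ℝ (Fin k) × EG).tangent ∞ (fun s => (⟨s, liftedField hX hφ a s⟩ :
        TangentBundle 𝓘(ℝ, EuclideanSpace ℝ (Fin k) × EG) (ξ.PullbackSpace φ))) := by
  intro s
  obtain ⟨W, Y, hWo, hs, hY, hW⟩ := ξ.exists_horizontal_vectorField X φ hX hφ (Pi.single a 1) s
  refine (hY.contMDiffAt (hWo.mem_nhds hs)).congr_of_eventuallyEq ?_
  filter_upwards [hWo.mem_nhds hs] with q hq
  obtain ⟨h₁, h₂⟩ := hW q hq
  refine congrArg (Bundle.TotalSpace.mk q) (eq_of_baseDeriv_eq_of_ptDeriv_eq q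
    ((baseDeriv_liftedField hX hφ a q).trans ?_) ((ptDeriv_liftedField hX hφ a q).trans ?_))
  · exact (h₁.trans (sum_pi_single_smul a _)).symm
  · exact (h₂.trans (sum_pi_single_smul (E := EP) a fun b => X.comp b q.pt)).symm

lemma liftedField_mem_horizontal (hX : X.IsInvariant G)
    (hφ : (ξ.reduced X hX).IsIntegralSection φ) (a : Fin k) (s : ξ.PullbackSpace φ) :
    liftedField hX hφ a s ∈ (ξ.inducedConnection X φ hX hφ).horizontal s :=
  (ξ.mem_inducedHorizontal X φ).2 ⟨Pi.single a 1,
    (baseDeriv_liftedField hX hφ a s).trans (sum_pi_single_smul a _).symm,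
    (ptDeriv_liftedField hX hφ a s).trans
      (sum_pi_single_smul (E := EP) a fun b => X.comp b s.pt).symm⟩

/-- The horizontal part of a vector field for the induced connection. -/
lemma inducedConnection_hor (hX : X.IsInvariant G) (hφ : (ξ.reduced X hX).IsIntegralSection φ)
    (Y : (s : ξ.PullbackSpace φ) → TangentSpace 𝓘(ℝ, EuclideanSpace ℝ (Fin k) × EG) s) :
    (ξ.inducedConnection X φ hX hφ).hor Y = fun s =>
      ∑ a, (baseDeriv s (Y s) : EuclideanSpace ℝ (Fin k)) a • liftedField hX hφ a s := by
  funext s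
  set v := ∑ a, (baseDeriv s (Y s) : EuclideanSpace ℝ (Fin k)) a • liftedField hX hφ a s with hv
  have hvh : v ∈ (ξ.inducedConnection X φ hX hφ).horizontal s :=
    Submodule.sum_mem _ fun a _ => Submodule.smul_mem _ _ (liftedField_mem_horizontal hX hφ a s)
  -- The combination `v` is built to have the same projection to `ℝᵏ` as `Y s`, so the two differ by
  -- a vertical vector.
  have hvv : Y s - v ∈ (ξ.pullback φ).vertical s := by
    have h1 : baseDeriv s v = baseDeriv s (Y s) :=
      (clm_sum_smul (baseDeriv s) _ fun a => baseDeriv_liftedField hX hφ a s).trans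
        (sum_smul_dt _)
    exact (map_sub (baseDeriv s) (Y s) v).trans (sub_eq_zero.2 h1.symm)
  change Submodule.projection _ _ ((ξ.inducedConnection X φ hX hφ).isCompl s) (Y s) = v
  rw [← add_sub_cancel v (Y s), map_add, Submodule.projection_apply_of_mem_left _ hvh,
    Submodule.projection_apply_of_mem_right _ hvv, add_zero]

lemma inducedConnection_hor_liftedField (hX : X.IsInvariant G)
    (hφ : (ξ.reduced X hX).IsIntegralSection φ) (a : Fin k) :
    (ξ.inducedConnection X φ hX hφ).hor (liftedField hX hφ a) = liftedField hX hφ a :=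
  funext fun s => Submodule.projection_apply_of_mem_left _ (liftedField_mem_horizontal hX hφ a s)

/-! ### Brackets of the lifted fields and curvature -/

section Complete

variable [CompleteSpace EG] [CompleteSpace EP]

/-- The lifted fields project to the commuting coordinate fields. Their bracket is therefore
vertical, and the curvature sees all of it. -/
lemma baseDeriv_mlieBracket_liftedField (hX : X.IsInvariant G)
    (hφ : (ξ.reduced X hX).IsIntegralSection φ) (a b : Fin k) (s : ξ.PullbackSpace φ) :
    baseDeriv s (mlieBracket 𝓘(ℝ, EuclideanSpace ℝ (Fin k) × EG) (liftedField hX hφ a)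
      (liftedField hX hφ b) s) = 0 := by
  have h := mfderiv_mlieBracket_of_related (x := s) (V := liftedField hX hφ a)
    (W := liftedField hX hφ b) (V' := fun _ => dt a) (W' := fun _ => dt b) contMDiff_base
    (contMDiff_liftedField hX hφ a s) (contMDiff_liftedField hX hφ b s)
    (contMDiff_opens_const _ _) (contMDiff_opens_const _ _)
    (baseDeriv_liftedField hX hφ a) (baseDeriv_liftedField hX hφ b)
  exact h.trans (mlieBracket_opens_const _ _ _)

lemma ptDeriv_mlieBracket_liftedField (hX : X.IsInvariant G)
    (hφ : (ξ.reduced X hX).IsIntegralSection φ) (a b : Fin k) (s : ξ.PullbackSpace φ) :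
    ptDeriv s (mlieBracket 𝓘(ℝ, EuclideanSpace ℝ (Fin k) × EG) (liftedField hX hφ a)
      (liftedField hX hφ b) s) = mlieBracket 𝓘(ℝ, EP) (X.comp a) (X.comp b) s.pt :=
  mfderiv_mlieBracket_of_related (x := s) (V := liftedField hX hφ a)
    (W := liftedField hX hφ b) contMDiff_pt
    (contMDiff_liftedField hX hφ a s) (contMDiff_liftedField hX hφ b s)
    (X.smooth a _) (X.smooth b _) (ptDeriv_liftedField hX hφ a) (ptDeriv_liftedField hX hφ b)

/-- The connection induced by `X` along `φ` is flat if and only if the components of `X` commute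
over the image of `φ`. -/
theorem isFlat_inducedConnection_iff (hX : X.IsInvariant G)
    (hφ : (ξ.reduced X hX).IsIntegralSection φ) :
    (ξ.inducedConnection X φ hX hφ).IsFlat ↔ ∀ (a b : Fin k) (s : ξ.PullbackSpace φ),
      mlieBracket 𝓘(ℝ, EP) (X.comp a) (X.comp b) s.pt = 0 := by
  constructor
  · intro h a b s
    have h1 := h (liftedField hX hφ a) (liftedField hX hφ b) (contMDiff_liftedField hX hφ a)
      (contMDiff_liftedField hX hφ b) s
    rw [PrincipalConnection.curvature, inducedConnection_hor_liftedField,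
      inducedConnection_hor_liftedField, neg_eq_zero] at h1
    -- Zero curvature makes the bracket horizontal. Being vertical as well, it has zero coefficients
    -- in the `Z_a`, so its `P`-component `[X_a, X_b]` vanishes.
    have h2 := (Submodule.projection_apply_eq_zero_iff _).1 h1
    obtain ⟨c, hc₁, hc₂⟩ := (ξ.mem_inducedHorizontal X φ).1 h2
    have hc : ∀ a, c a = 0 := sum_smul_dt_eq_zero
      (hc₁.symm.trans (baseDeriv_mlieBracket_liftedField hX hφ a b s))
    refine (ptDeriv_mlieBracket_liftedField hX hφ a b s).symm.trans (hc₂.trans ?_)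
    exact Finset.sum_eq_zero fun a _ => by rw [hc a, zero_smul]
  · intro h Y Y' hY hY' s
    have hbr : ∀ a b, mlieBracket 𝓘(ℝ, EuclideanSpace ℝ (Fin k) × EG) (liftedField hX hφ a)
        (liftedField hX hφ b) s = 0 := fun a b =>
      eq_of_baseDeriv_eq_of_ptDeriv_eq s
        ((baseDeriv_mlieBracket_liftedField hX hφ a b s).trans (map_zero (baseDeriv s)).symm)
        ((ptDeriv_mlieBracket_liftedField hX hφ a b s).trans
          ((h a b s).trans (map_zero (ptDeriv s)).symm))
    rw [PrincipalConnection.curvature, inducedConnection_hor, inducedConnection_hor, neg_eq_zero]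
    -- It remains to see that the bracket of the two horizontal parts, both function combinations of
    -- the commuting `Z_a`, is horizontal.
    refine (Submodule.projection_apply_eq_zero_iff _).2 ?_
    exact mlieBracket_sum_smul_sum_smul_mem _ (fun a => contMDiff_liftedField hX hφ a s)
      (fun a => contMDiff_baseDeriv_apply hY a s) (fun a => contMDiff_baseDeriv_apply hY' a s)
      (fun a => liftedField_mem_horizontal hX hφ a s) hbr

end Complete

/-- The projection of an integral section of `X` is an integral section of the reduced
`k`-vector field. -/
lemma isIntegrable_reduced (hX : X.IsInvariant G) (h : X.IsIntegrable) :
    (ξ.reduced X hX).IsIntegrable := by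
  intro b
  obtain ⟨p, rfl⟩ := ξ.surjective_proj b
  obtain ⟨V, ψ, hψ, hp⟩ := h p
  refine ⟨V, ⟨ξ.proj ∘ ψ, ξ.contMDiff_proj.comp ψ.contMDiff⟩, ⟨hψ.1, fun t a => ?_⟩,
    fun t ht => congrArg ξ.proj (hp t ht)⟩
  have h1 := mfderiv_comp t (ξ.contMDiff_proj.mdifferentiable (by simp) (ψ t))
    (ψ.contMDiff.mdifferentiable (by simp) t)
  refine (congrArg (fun L : EuclideanSpace ℝ (Fin k) →L[ℝ] EB => L (dt a)) h1).trans ?_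
  refine Eq.trans ?_ (ξ.reducedComp_proj hX a (ψ t))
  exact congrArg (mfderiv 𝓘(ℝ, EP) 𝓘(ℝ, EB) ξ.proj (ψ t) : EP →L[ℝ] EB) (hψ.2 t a)

end PrincipalBundle

end InducedConnectionFlat

end

/-! ### The integrability criterion -/

theorem mainTheorem2
    {EG : Type*} [NormedAddCommGroup EG] [NormedSpace ℝ EG] [FiniteDimensional ℝ EG]
    {EP : Type*} [NormedAddCommGroup EP] [NormedSpace ℝ EP] [FiniteDimensional ℝ EP]
    {EB : Type*} [NormedAddCommGroup EB] [NormedSpace ℝ EB] [FiniteDimensional ℝ EB]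
    {G : Type*} [TopologicalSpace G] [ChartedSpace EG G] [Group G] [LieGroup 𝓘(ℝ, EG) ∞ G]
    {P : Type*} [TopologicalSpace P] [T2Space P] [ChartedSpace EP P] [IsManifold 𝓘(ℝ, EP) ∞ P]
    [MulAction G P] [ContMDiffSMul 𝓘(ℝ, EG) 𝓘(ℝ, EP) ∞ G P]
    {B : Type*} [TopologicalSpace B] [T2Space B] [ChartedSpace EB B] [IsManifold 𝓘(ℝ, EB) ∞ B]
    (ξ : PrincipalBundle EG EP EB G P B)
    {k : ℕ} (X : KVectorField k EP P) (hX : X.IsInvariant G) :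
    X.IsIntegrable ↔
      (ξ.reduced X hX).IsIntegrable ∧
      ∀ (U : TopologicalSpace.Opens (EuclideanSpace ℝ (Fin k)))
        (φ : C^∞⟮𝓘(ℝ, EuclideanSpace ℝ (Fin k)), U; 𝓘(ℝ, EB), B⟯)
        (hφ : (ξ.reduced X hX).IsIntegralSection φ),
        (ξ.inducedConnection X φ hX hφ).IsFlat := by
  have := FiniteDimensional.complete ℝ EG
  have := FiniteDimensional.complete ℝ EP
  refine ⟨fun h => ⟨PrincipalBundle.isIntegrable_reduced hX h, fun U φ hφ => ?_⟩, ?_⟩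
  · exact (PrincipalBundle.isFlat_inducedConnection_iff hX hφ).2 fun a b s =>
      KVectorField.isIntegrable_iff_mlieBracket_eq_zero.1 h a b s.pt
  · rintro ⟨h₁, h₂⟩
    refine KVectorField.isIntegrable_of_mlieBracket_eq_zero fun a b p => ?_
    -- For a section through `ξ.proj p`, the pair `(0, p)` is a point of `φ^*P`, where flatness
    -- gives the bracket at `p`.
    obtain ⟨U, φ, hφ, hp⟩ := h₁ (ξ.proj p)
    exact (PrincipalBundle.isFlat_inducedConnection_iff hX hφ).1 (h₂ U φ hφ) a b
      ⟨⟨0, hφ.1⟩, p, hp ⟨0, hφ.1⟩ rfl⟩
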